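/- **Theorem (Uniform Boundedness Theorem).** Let $X$ and $Y$ be computable Banach spaces over $\mathbb F$ (where $\mathbb F=\mathbb R$ or $\mathbb F=\mathbb C$), both different from $\{0\}$. Then $\mathsf{UBT}_{X,Y}\equiv_{\mathrm W}\mathsf C_{\mathbb N}$. *Multi-valued functions.* $\mathsf{UBT}_{X,Y}:\subseteq\mathcal C(X,Y)^{\mathbb N}\rightrightarrows\mathbb N$ maps $(T_i)_{i\in\mathbb N}$ to $\{M\in\mathbb N:\sup_{i}\|T_i\|\le M\}$; its domain consists of all sequences of bounded linear operators $T_i:X\to Y$ such that $\{\|T_ix\|:i\in\mathbb N\}$ is bounded for each $x\in X$. Discrete choice $\mathsf C_{\mathbb N}:\subseteq\mathcal A_-(\mathbb N)\rightrightarrows\mathbb N$ maps each non-empty $A\subseteq\mathbb N$ to the set $A$ of its possible values. *Computable Banach spaces.* A computable Banach space is a Banach space $X$ over $\mathbb F$ with a sequence $(e_i)_{i\in\mathbb N}$ whose linear span is dense in $X$ and such that, for the standard numbering $\alpha$ of all finite linear combinations of the $e_i$ with coefficients in $\mathbb Q$ (in $\mathbb Q+i\mathbb Q$ if $\mathbb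 F=\mathbb C$), the double sequence of reals $(\|\alpha(i)-\alpha(j)\|)_{i,j}$ is computable. *Representations.* A representation of a set $Z$ is a partial surjective map $\delta_Z:\subseteq\mathbb N^{\mathbb N}\to Z$; if $\delta_Z(p)=z$, then $p$ is a name of $z$. The following are used. A name of $n\in\mathbb N$ is the constant sequence with value $n$. A name of $A\in\mathcal A_-(\mathbb N)$ is any $p$ with $\mathbb N\setminus A=\{n:n+1\in\operatorname{range}(p)\}$. A name of $x\in X$ is any $p$ with $\|\alpha(p(i))-\alpha(p(j))\|\le 2^{-i}$ for all $i<j$ and $\lim_i\alpha(p(i))=x$. The set $\mathcal C(X,Y)$ of continuous functions $T:X\to Y$ carries the canonical function space representation: a name of $T$ is an associate of a partial continuous function on $\mathbb N^{\mathbb N}$ that maps every name of every $x\in X$ to some name of $Tx$. Here $p$ is an associate of $F$ if, for every $q\in\operatorname{dom}(F)$ and $n\in\mathbb N$, one has $F(q)(n)=m$ where $m+1$ is the first non-zero number among $p\langle n,(q(0),\dots,q(k-1))\rangle$, $k=0,1,2,\dots$. A name of a sequence $(z_i)_{i}$ is any $p$ such that $n\mapsto p\langle i,n\rangle$ is a name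 of $z_i$ for each $i$. *Weihrauch reducibility.* A realizer of $f:\subseteq Z\rightrightarrows W$ is a partial $F:\subseteq\mathbb N^{\mathbb N}\to\mathbb N^{\mathbb N}$ that maps every name of every $z\in\operatorname{dom}(f)$ to a name of some element of $f(z)$. One writes $f\le_{\mathrm W}g$ if there are computable partial functions $H,K:\subseteq\mathbb N^{\mathbb N}\to\mathbb N^{\mathbb N}$ such that for every realizer $G$ of $g$ the function $p\mapsto H\langle p,GK(p)\rangle$ is a realizer of $f$, and $f\equiv_{\mathrm W}g$ if $f\le_{\mathrm W}g$ and $g\le_{\mathrm W}f$. -/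

import Mathlib

namespace Weih

/-! ### Computability on Baire space -/

/-- Baire space. -/
abbrev Baire : Type := ℕ → ℕ

/-- Partial recursive functionals `Φ p n` in a number argument `n` and an oracle `p`: the least
class that contains the basic functions and the oracle `n ↦ p n` and is closed under pairing,
composition, primitive recursion and unbounded search, uniformly in `p`. -/
inductive OracleRec : (Baire → ℕ →. ℕ) → Prop
  | zero : OracleRec fun _ _ => Part.some 0
  | succ : OracleRec fun _ n => Part.some (n + 1)
  | left : OracleRec fun _ n => Part.some n.unpair.1
  | right : OracleRec fun _ n => Part.some n.unpair.2
  | oracle : OracleRec fun p n => Part.some (p n)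
  | pair {Φ Ψ : Baire → ℕ →. ℕ} : OracleRec Φ → OracleRec Ψ →
      OracleRec fun p n => Nat.pair <$> Φ p n <*> Ψ p n
  | comp {Φ Ψ : Baire → ℕ →. ℕ} : OracleRec Φ → OracleRec Ψ →
      OracleRec fun p n => Ψ p n >>= Φ p
  | prec {Φ Ψ : Baire → ℕ →. ℕ} : OracleRec Φ → OracleRec Ψ →
      OracleRec fun p => Nat.unpaired fun a n =>
        n.rec (Φ p a) fun y IH => IH.bind fun i => Ψ p (Nat.pair a (Nat.pair y i))
  | rfind {Φ : Baire → ℕ →. ℕ} : OracleRec Φ →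
      OracleRec fun p a => Nat.rfind fun n => (fun m => decide (m = 0)) <$> Φ p (Nat.pair a n)

/-- A partial function `F` on Baire space is computable if one oracle computation produces
`F p` digit by digit; `F p` is defined exactly when all digits are produced. -/
def ComputableFun (F : Baire →. Baire) : Prop :=
  ∃ Φ : Baire → ℕ →. ℕ, OracleRec Φ ∧ ∀ p q : Baire, q ∈ F p ↔ ∀ n, q n ∈ Φ p n

/-- The standard pairing on Baire space (interleaving). -/
def pairing (p q : Baire) : Baire := fun n => if n % 2 = 0 then p (n / 2) else q (n / 2)

/-! ### Represented spaces, realizers, Weihrauch reducibility -/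

/-- A representation: a partial surjective map from Baire space onto `X`, given by its graph. -/
structure Representation (X : Type*) where
  Names : Baire → X → Prop
  unique : ∀ {p x y}, Names p x → Names p y → x = y
  surj : ∀ x, ∃ p, Names p x

/-- A partial multi-valued function between represented spaces. -/
structure MultiFun {X Y : Type*} (δX : Representation X) (δY : Representation Y) where
  dom : Set X
  val : X → Set Y

/-- `F` is a realizer of `f`. -/
def Realizes {X Y : Type*} {δX : Representation X} {δY : Representation Y}
    (F : Baire →. Baire) (f : MultiFun δX δY) : Prop :=
  ∀ p x, δX.Names p x → x ∈ f.dom → ∃ q ∈ F p, ∃ y ∈ f.val x, δY.Names q y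

/-- The partial function `H ⟨id, G K⟩`. -/
def composite (H G K : Baire →. Baire) : Baire →. Baire := fun p =>
  (K p).bind fun k => (G k).bind fun g => H (pairing p g)

/-- Weihrauch reducibility of sets of partial functions on Baire space. -/
def SetReducible (𝓕 𝓖 : Set (Baire →. Baire)) : Prop :=
  ∃ H K : Baire →. Baire, ComputableFun H ∧ ComputableFun K ∧
    ∀ G ∈ 𝓖, ∃ F ∈ 𝓕, F = composite H G K

section

variable {X Y Z W : Type*} {δX : Representation X} {δY : Representation Y}
  {δZ : Representation Z} {δW : Representation W}

/-- Weihrauch reducibility of multi-valued functions on represented spaces. -/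
def Reducible (f : MultiFun δX δY) (g : MultiFun δZ δW) : Prop :=
  SetReducible {F | Realizes F f} {G | Realizes G g}

/-- Weihrauch equivalence. -/
def Equivalent (f : MultiFun δX δY) (g : MultiFun δZ δW) : Prop :=
  Reducible f g ∧ Reducible g f

end

/-! ### Natural numbers, sequences, and discrete choice -/

/-- The name of `n` is the constant sequence with value `n`. -/
def natRep : Representation ℕ where
  Names p n := ∀ k, p k = n
  unique h h' := (h 0).symm.trans (h' 0)
  surj n := ⟨fun _ => n, fun _ => rfl⟩

/-- The closed subsets of the discrete space `ℕ` with negative information: a name of `A`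
enumerates the complement of `A` (shifted by one, so that `0` means no information). -/
def negRep : Representation (Set ℕ) where
  Names p A := ∀ n, n ∉ A ↔ ∃ k, p k = n + 1
  unique {p A B} hA hB := by
    ext n
    exact not_iff_not.mp ((hA n).trans (hB n).symm)
  surj A := by
    classical
    refine ⟨fun k => if k ∈ A then 0 else k + 1, fun n => ⟨fun hn => ⟨n, by simp [hn]⟩, ?_⟩⟩
    rintro ⟨k, hk⟩ hn
    by_cases hkA : k ∈ A
    · simp [hkA] at hk
    · simp only [hkA, if_false] at hk
      have : k = n := by omega
      exact hkA (this ▸ hn)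

/-- Sequences in a represented space. -/
def seqRep {X : Type*} (δ : Representation X) : Representation (ℕ → X) where
  Names p x := ∀ i, δ.Names (fun n => p (Nat.pair i n)) (x i)
  unique h h' := funext fun i => δ.unique (h i) (h' i)
  surj x := by
    choose p hp using fun i => δ.surj (x i)
    exact ⟨fun m => p m.unpair.1 m.unpair.2, fun i => by simpa using hp i⟩

/-- Discrete choice `C_ℕ`. -/
def discreteChoice : MultiFun negRep natRep where
  dom := {A | A.Nonempty}
  val A := A

/-! ### Computable metric spaces and spaces of continuous functions -/

/-- A standard numbering of the rational numbers: `⟨⟨a, b⟩, c⟩ ↦ (a - b) / (c + 1)`. -/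
def ratNum (n : ℕ) : ℚ :=
  ((n.unpair.1.unpair.1 : ℚ) - n.unpair.1.unpair.2) / (n.unpair.2 + 1)

/-- A computable double sequence of real numbers: rational approximations of any given
precision can be computed. -/
def ComputableRealSeq (a : ℕ → ℕ → ℝ) : Prop :=
  ∃ f : ℕ × ℕ × ℕ → ℕ, Computable f ∧
    ∀ i j k, |a i j - (ratNum (f (i, j, k)) : ℝ)| ≤ (1 / 2) ^ k

/-- The structure of a computable metric space on a metric space: a dense sequence on which the
metric is computable. -/
structure ComputableMetric (X : Type*) [MetricSpace X] where
  pt : ℕ → X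
  dense : DenseRange pt
  computable_dist : ComputableRealSeq fun i j => dist (pt i) (pt j)

section

open Filter Topology

variable {X Y : Type*} [MetricSpace X] [MetricSpace Y]

/-- `p` is a Cauchy name of `x`: the points with indices `p 0, p 1, …` converge fast to `x`. -/
def CauchyName (c : ComputableMetric X) (p : Baire) (x : X) : Prop :=
  (∀ i j, i < j → dist (c.pt (p i)) (c.pt (p j)) ≤ (1 / 2 : ℝ) ^ i) ∧
    Tendsto (fun n => c.pt (p n)) atTop (𝓝 x)

theorem CauchyName.dist_le {c : ComputableMetric X} {p : Baire} {x : X} (h : CauchyName c p x)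
    (n : ℕ) : dist (c.pt (p n)) x ≤ (1 / 2 : ℝ) ^ n := by
  refine le_of_tendsto (tendsto_const_nhds.dist h.2) ?_
  filter_upwards [eventually_gt_atTop n] with m hm using h.1 n m hm

theorem CauchyName.of_dist_le {c : ComputableMetric X} {p : Baire} {x : X}
    (h : ∀ n, dist (c.pt (p n)) x ≤ (1 / 2 : ℝ) ^ (n + 1)) : CauchyName c p x := by
  constructor
  · intro i j hij
    have h1 : (1 / 2 : ℝ) ^ (j + 1) ≤ (1 / 2) ^ (i + 1) :=
      pow_le_pow_of_le_one (by norm_num) (by norm_num) (by omega)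
    have h2 := dist_triangle_right (c.pt (p i)) (c.pt (p j)) x
    have h3 : (1 / 2 : ℝ) ^ (i + 1) + (1 / 2) ^ (i + 1) = (1 / 2) ^ i := by ring
    linarith [h i, h j]
  · rw [tendsto_iff_dist_tendsto_zero]
    refine squeeze_zero (fun _ => dist_nonneg) h ?_
    exact (tendsto_pow_atTop_nhds_zero_of_lt_one (by norm_num : (0 : ℝ) ≤ 1 / 2)
      (by norm_num)).comp (tendsto_add_atTop_nat 1)

/-- The Cauchy representation of a computable metric space. -/
def cauchyRep (c : ComputableMetric X) : Representation X where
  Names := CauchyName c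
  unique h h' := tendsto_nhds_unique h.2 h'.2
  surj x := by
    choose p hp using fun n : ℕ =>
      c.dense.exists_dist_lt x (by positivity : (0 : ℝ) < (1 / 2) ^ (n + 1))
    exact ⟨p, .of_dist_le fun n => by rw [dist_comm]; exact (hp n).le⟩

/-- The question put to an associate: the number `n` together with the first `k` values of `q`. -/
def query (n : ℕ) (q : Baire) (k : ℕ) : ℕ :=
  Nat.pair n (Encodable.encode ((List.range k).map q))

/-- `Associate p q r`: the partial continuous function on Baire space with associate `p`
maps `q` to `r`. The digit `r n` is `m` if the first non-zero answer of `p` to the questions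
`query n q 0, query n q 1, …` is `m + 1`. -/
def Associate (p q r : Baire) : Prop :=
  ∀ n, ∃ k, (∀ j < k, p (query n q j) = 0) ∧ p (query n q k) = r n + 1

/-- `p` is an associate of some realizer of `T`. -/
def FunctionName (c : ComputableMetric X) (d : ComputableMetric Y) (p : Baire) (T : C(X, Y)) :
    Prop :=
  ∀ q x, CauchyName c q x → ∃ r, Associate p q r ∧ CauchyName d r (T x)

theorem Associate.unique {p q r s : Baire} (h : Associate p q r) (h' : Associate p q s) :
    r = s := by
  funext n
  obtain ⟨k, hk, hr⟩ := h n
  obtain ⟨l, hl, hs⟩ := h' n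
  rcases lt_trichotomy k l with hkl | rfl | hkl
  · have := hl k hkl
    omega
  · omega
  · have := hk l hkl
    omega

theorem exists_functionName (c : ComputableMetric X) (d : ComputableMetric Y) (T : C(X, Y)) :
    ∃ p, FunctionName c d p T := by
  classical
  let P : ℕ → List ℕ → ℕ → Prop := fun n w m =>
    ∀ q x, CauchyName c q x → (List.range w.length).map q = w →
      dist (d.pt m) (T x) ≤ (1 / 2 : ℝ) ^ (n + 1)
  let g : ℕ → List ℕ → ℕ := fun n w => if h : ∃ m, P n w m then h.choose + 1 else 0
  refine ⟨fun a => g a.unpair.1 (Denumerable.ofNat (List ℕ) a.unpair.2), fun q x hq => ?_⟩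
  have hg : ∀ n k, (fun a => g a.unpair.1 (Denumerable.ofNat (List ℕ) a.unpair.2))
      (query n q k) = g n ((List.range k).map q) := by
    intro n k
    simp [query]
  have hex : ∀ n, ∃ k, g n ((List.range k).map q) ≠ 0 := by
    intro n
    have hε : (0 : ℝ) < (1 / 2) ^ (n + 1) / 2 := by positivity
    obtain ⟨m, hm⟩ := d.dense.exists_dist_lt (T x) hε
    obtain ⟨η, hη, hT⟩ := Metric.continuousAt_iff.mp (T.continuous.continuousAt (x := x)) _ hε
    obtain ⟨k, hk⟩ := exists_pow_lt_of_lt_one (half_pos hη) (by norm_num : (1 / 2 : ℝ) < 1)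
    refine ⟨k + 1, ?_⟩
    have : ∃ m, P n ((List.range (k + 1)).map q) m := by
      refine ⟨m, fun q' x' hq' hw => ?_⟩
      have hqq : q' k = q k := by
        have := congrArg (fun l : List ℕ => l[k]?) hw
        simpa using this
      have h1 := hq'.dist_le k
      have h2 := hq.dist_le k
      rw [hqq] at h1
      have h3 : dist x' x < η := by
        have := dist_triangle_left x' x (c.pt (q k))
        linarith
      have h4 := hT h3
      have h5 := dist_triangle (d.pt m) (T x) (T x')
      rw [dist_comm] at hm h4
      linarith
    simp [g, this]
  refine ⟨fun n => g n ((List.range (Nat.find (hex n))).map q) - 1, fun n => ?_,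
    .of_dist_le fun n => ?_⟩
  · refine ⟨Nat.find (hex n), fun j hj => ?_, ?_⟩
    · rw [hg]
      exact not_not.mp (Nat.find_min (hex n) hj)
    · rw [hg]
      exact (Nat.sub_add_cancel (Nat.one_le_iff_ne_zero.mpr (Nat.find_spec (hex n)))).symm
  · have hne := Nat.find_spec (hex n)
    set w := (List.range (Nat.find (hex n))).map q with hw
    by_cases h : ∃ m, P n w m
    · have : g n w - 1 = h.choose := by simp [g, h]
      rw [this]
      refine h.choose_spec q x hq ?_
      simp [hw]
    · exact absurd (by simp [g, h]) hne

/-- The canonical representation of the space of continuous functions. -/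
def functionRep (c : ComputableMetric X) (d : ComputableMetric Y) : Representation C(X, Y) where
  Names := FunctionName c d
  unique {p S T} hS hT := by
    ext x
    obtain ⟨q, hq⟩ := (cauchyRep c).surj x
    obtain ⟨r, hr, hr'⟩ := hS q x hq
    obtain ⟨s, hs, hs'⟩ := hT q x hq
    obtain rfl := hr.unique hs
    exact (cauchyRep d).unique hr' hs'
  surj := exists_functionName c d

end

/-! ### Computable Banach spaces and the Uniform Boundedness Theorem -/

section

variable {𝕜 : Type*} [RCLike 𝕜]

/-- A standard numbering of the rational scalars, `ℚ` or `ℚ + iℚ` (`RCLike.I = 0` over `ℝ`). -/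
noncomputable def scalarNum (𝕜 : Type*) [RCLike 𝕜] (n : ℕ) : 𝕜 :=
  (ratNum n.unpair.1 : 𝕜) + (ratNum n.unpair.2 : 𝕜) * RCLike.I

/-- The standard numbering of the rational linear combinations of a sequence `e`. -/
noncomputable def combination (𝕜 : Type*) [RCLike 𝕜] {X : Type*} [NormedAddCommGroup X]
    [NormedSpace 𝕜 X] (e : ℕ → X) (n : ℕ) : X :=
  ∑ i ∈ Finset.range (Denumerable.ofNat (List ℕ) n).length,
    scalarNum 𝕜 ((Denumerable.ofNat (List ℕ) n).getD i 0) • e i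

theorem ratNum_surjective : Function.Surjective ratNum := by
  intro q
  refine ⟨Nat.pair (Nat.pair q.num.toNat (-q.num).toNat) (q.den - 1), ?_⟩
  have h1 : ((q.num.toNat : ℚ) - ((-q.num).toNat : ℚ)) = q.num := by
    have := Int.toNat_sub_toNat_neg q.num
    exact_mod_cast this
  have h2 : ((q.den - 1 : ℕ) : ℚ) + 1 = q.den := by
    have := q.den_pos
    exact_mod_cast Nat.sub_add_cancel this
  simp only [ratNum, Nat.unpair_pair, h1, h2]
  exact Rat.num_div_den q

theorem scalarNum_dense : DenseRange (scalarNum 𝕜) := by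
  have hq : DenseRange fun n => ((ratNum n : ℚ) : ℝ) :=
    Rat.denseRange_cast.comp ratNum_surjective.denseRange Rat.continuous_coe_real
  have hc : Continuous fun z : ℝ × ℝ => (z.1 : 𝕜) + (z.2 : 𝕜) * RCLike.I := by fun_prop
  have hs : Function.Surjective fun z : ℝ × ℝ => (z.1 : 𝕜) + (z.2 : 𝕜) * RCLike.I :=
    fun z => ⟨(RCLike.re z, RCLike.im z), RCLike.re_add_im z⟩
  have h := (hs.denseRange.comp (hq.prodMap hq) hc).comp
    Nat.pairEquiv.symm.surjective.denseRange (by fun_prop)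
  convert h using 1
  funext n
  simp only [scalarNum, Function.comp_apply, Prod.map, RCLike.ofReal_ratCast]
  rfl

variable {X : Type*} [NormedAddCommGroup X] [NormedSpace 𝕜 X]

theorem combination_dense {e : ℕ → X}
    (he : Dense (Submodule.span 𝕜 (Set.range e) : Set X)) : DenseRange (combination 𝕜 e) := by
  refine (dense_closure.mp (he.mono ?_))
  intro x hx
  obtain ⟨a, rfl⟩ := Finsupp.mem_span_range_iff_exists_finsupp.mp hx
  obtain ⟨N, hN⟩ := a.support.exists_nat_subset_range
  have hsum : (a.sum fun i c => c • e i) = ∑ i ∈ Finset.range N, a i • e i :=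
    Finset.sum_subset hN fun i _ hi => by simp [Finsupp.notMem_support_iff.mp hi]
  rw [hsum]
  let g : (ℕ → 𝕜) → X := fun b => ∑ i ∈ Finset.range N, b i • e i
  have hgc : Continuous g := by fun_prop
  have hd : DenseRange (Pi.map fun _ : ℕ => scalarNum 𝕜) :=
    DenseRange.piMap fun _ => scalarNum_dense
  have hmem := hgc.range_subset_closure_image_dense hd ⟨(a : ℕ → 𝕜), rfl⟩
  refine closure_mono ?_ hmem
  rintro _ ⟨_, ⟨m, rfl⟩, rfl⟩
  refine ⟨Encodable.encode ((List.range N).map m), ?_⟩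
  simp only [combination, Denumerable.ofNat_encode, g, List.length_map, List.length_range]
  refine Finset.sum_congr rfl fun i hi => ?_
  have hi' := Finset.mem_range.mp hi
  simp [hi', Pi.map]

/-- The structure of a computable Banach space on a Banach space: a sequence with dense linear
span such that the metric is computable on the rational linear combinations. -/
structure ComputableBanach (𝕜 : Type*) [RCLike 𝕜] (X : Type*) [NormedAddCommGroup X]
    [NormedSpace 𝕜 X] [CompleteSpace X] where
  basis : ℕ → X
  dense_span : Dense (Submodule.span 𝕜 (Set.range basis) : Set X)
  computable_dist :
    ComputableRealSeq fun i j => dist (combination 𝕜 basis i) (combination 𝕜 basis j)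

/-- The induced computable metric space. -/
noncomputable def ComputableBanach.metric [CompleteSpace X] (c : ComputableBanach 𝕜 X) :
    ComputableMetric X where
  pt := combination 𝕜 c.basis
  dense := combination_dense c.dense_span
  computable_dist := c.computable_dist

variable {Y : Type*} [NormedAddCommGroup Y] [NormedSpace 𝕜 Y] [CompleteSpace X] [CompleteSpace Y]

/-- The Uniform Boundedness Theorem as a multi-valued function: a pointwise bounded sequence of
bounded linear operators is mapped to all natural-number bounds of the operator norms. -/
def UBT (cX : ComputableBanach 𝕜 X) (cY : ComputableBanach 𝕜 Y) :
    MultiFun (seqRep (functionRep cX.metric cY.metric)) natRep where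
  dom := {T | (∀ i, IsBoundedLinearMap 𝕜 (T i)) ∧
    ∀ x, BddAbove (Set.range fun i => ‖T i x‖)}
  val T := {M | ∃ L : ℕ → X →L[𝕜] Y, (∀ i x, L i x = T i x) ∧ ∀ i, ‖L i‖ ≤ (M : ℝ)}

end

end Weih

namespace Weih

/-! ### Oracle computations -/

/-! Reduction to choice. Whether `M` fails to bound the operator norms is semi-decidable: it fails
iff `M * ‖x‖ < ‖T_i x‖` for some `i` and some point `x` of the dense sequence, and approximations of
the two norms reveal a strict inequality at some finite stage. So the complement of the set of
bounds can be enumerated from a name of the sequence (`exists_nonBound_iff`). Banach–Steinhaus makes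
the set of bounds non-empty, and discrete choice picks an element.

Reduction of choice. Given an enumeration of the complement of `A`, keep as `candidate` the least
number not yet enumerated, and call stage `i` a refutation if it enumerates the current candidate.
An element of `A` is never enumerated, so there are only finitely many refutations
(`exists_refutation_le`). With a fixed rank-one operator scaled so that its norm is at least one,
let `T_i` be its multiple by `i + 1` if stage `i` is a refutation, and zero otherwise. A bound `M`
of the norms excludes refutations from stage `M` on, so the candidate after `M` stages lies in `A`
(`ne_candidate_of_refutation_le`).

The rank-one operator needs a computable non-zero functional on `X`. Only its existence matters, so
finitely many data may be chosen without an algorithm. At level `s`, a list of rational values on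
the first `s` vectors passes a decidable test, `Admissible`, made of finitely many inequalities.
Close approximations of a functional of norm at most one pass. Conversely, by Hahn–Banach, a list
that passes is close to such a functional (`exists_approximates_of_admissible`). Hence every
admissible list has a nearby admissible successor, and a blind search finds one. The resulting
sequence converges computably to the values of a functional (`exists_approximates_seq`), which is
non-zero because the starting list is close to a norming functional of some non-zero `e i₀`. -/

theorem OracleRec.of_partrec {f : ℕ →. ℕ} (hf : Nat.Partrec f) : OracleRec fun _ => f := by
  induction hf with
  | zero => exact .zero
  | succ => exact .succ
  | left => exact .left
  | right => exact .right
  | pair _ _ h h' => exact .pair h h'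
  | comp _ _ h h' => exact .comp h h'
  | prec _ _ h h' => exact .prec h h'
  | rfind _ h => exact .rfind h

/-- A total functional with a number argument and an oracle is computable. -/
def OracleComputable (h : Baire → ℕ → ℕ) : Prop :=
  OracleRec fun p n => Part.some (h p n)

namespace OracleComputable

theorem of_computable {f : ℕ → ℕ} (hf : Computable f) : OracleComputable fun _ => f :=
  .of_partrec (Partrec.nat_iff.mp hf)

theorem oracle : OracleComputable fun p n => p n := OracleRec.oracle

theorem comp {f g : Baire → ℕ → ℕ} (hf : OracleComputable f) (hg : OracleComputable g) :
    OracleComputable fun p n => f p (g p n) := by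
  have := OracleRec.comp hf hg
  simpa [OracleComputable] using this

theorem pair {f g : Baire → ℕ → ℕ} (hf : OracleComputable f) (hg : OracleComputable g) :
    OracleComputable fun p n => Nat.pair (f p n) (g p n) := by
  have := OracleRec.pair hf hg
  simpa [OracleComputable, Seq.seq] using this

theorem primRec {f g : Baire → ℕ → ℕ} (hf : OracleComputable f) (hg : OracleComputable g) :
    OracleComputable fun p n =>
      n.unpair.2.rec (f p n.unpair.1) fun y c => g p (Nat.pair n.unpair.1 (Nat.pair y c)) := by
  have := OracleRec.prec hf hg
  refine (congrArg OracleRec ?_).mp this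
  funext p n
  simp only [Nat.unpaired]
  induction n.unpair.2 with
  | zero => rfl
  | succ y ih => simp [ih]

theorem comp_computable₂ {g : ℕ → ℕ → ℕ} (hg : Computable₂ g) {a b : Baire → ℕ → ℕ}
    (ha : OracleComputable a) (hb : OracleComputable b) :
    OracleComputable fun p n => g (a p n) (b p n) := by
  have h : Computable fun n : ℕ => g n.unpair.1 n.unpair.2 :=
    hg.comp (Computable.fst.comp Computable.unpair) (Computable.snd.comp Computable.unpair)
  simpa using (of_computable h).comp (ha.pair hb)

theorem encode_prefix : OracleComputable fun p n => Encodable.encode ((List.range n).map p) := by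
  have hstep : Computable₂ fun c x : ℕ => Encodable.encode (Denumerable.ofNat (List ℕ) c ++ [x]) :=
    Computable.encode.comp (Computable.list_concat.comp
      ((Computable.ofNat _).comp Computable.fst) Computable.snd)
  have hleft : OracleComputable fun _ n => n.unpair.1 :=
    of_computable (Computable.fst.comp Computable.unpair)
  have hright : OracleComputable fun _ n => n.unpair.2 :=
    of_computable (Computable.snd.comp Computable.unpair)
  have hg := comp_computable₂ hstep (hright.comp hright) (oracle.comp (hleft.comp hright))
  have h0 : OracleComputable fun _ _ => 0 := of_computable (Computable.const 0)
  have hid : OracleComputable fun _ n => n := of_computable Computable.id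
  have := (primRec h0 hg).comp (h0.pair hid)
  convert this using 3 with p n
  simp only [Nat.unpair_pair]
  induction n with
  | zero => rfl
  | succ n ih => simp [← ih, List.range_succ]

/-- An ordinary computable function applied to a finite part of the oracle. The less direct oracle
computations below take this form, so that their computability reduces to that of functions on
lists. -/
theorem of_prefix {g : ℕ → List ℕ → ℕ}
    (hg : Computable₂ g) {u : Baire → ℕ → ℕ} (hu : OracleComputable u) :
    OracleComputable fun p n => g n ((List.range (u p n)).map p) := by
  have h : Computable₂ fun n c => g n (Denumerable.ofNat (List ℕ) c) :=
    hg.comp Computable.fst ((Computable.ofNat _).comp Computable.snd)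
  have := comp_computable₂ h (of_computable Computable.id) (encode_prefix.comp hu)
  simpa using this

theorem computableFun {h : Baire → ℕ → ℕ} (hh : OracleComputable h) :
    ComputableFun fun p => Part.some (h p) := by
  refine ⟨_, hh, fun p q => ?_⟩
  simp [funext_iff]

end OracleComputable

/-! ### Arithmetic on codes of rational numbers -/

/-- Addition on codes of rational numbers. -/
def codeAdd (x y : ℕ) : ℕ :=
  Nat.pair (Nat.pair (x.unpair.1.unpair.1 * (y.unpair.2 + 1) + y.unpair.1.unpair.1 * (x.unpair.2 + 1))
    (x.unpair.1.unpair.2 * (y.unpair.2 + 1) + y.unpair.1.unpair.2 * (x.unpair.2 + 1)))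
    ((x.unpair.2 + 1) * (y.unpair.2 + 1) - 1)

/-- Multiplication on codes of rational numbers. -/
def codeMul (x y : ℕ) : ℕ :=
  Nat.pair (Nat.pair
    (x.unpair.1.unpair.1 * y.unpair.1.unpair.1 + x.unpair.1.unpair.2 * y.unpair.1.unpair.2)
    (x.unpair.1.unpair.1 * y.unpair.1.unpair.2 + x.unpair.1.unpair.2 * y.unpair.1.unpair.1))
    ((x.unpair.2 + 1) * (y.unpair.2 + 1) - 1)

/-- Negation on codes of rational numbers. -/
def codeNeg (x : ℕ) : ℕ :=
  Nat.pair (Nat.pair x.unpair.1.unpair.2 x.unpair.1.unpair.1) x.unpair.2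

/-- An upper bound for the absolute value, on codes of rational numbers. -/
def codeAbs (x : ℕ) : ℕ :=
  Nat.pair (Nat.pair (x.unpair.1.unpair.1 + x.unpair.1.unpair.2) 0) x.unpair.2

/-- A code of the natural number `n`. -/
def codeNat (n : ℕ) : ℕ := Nat.pair (Nat.pair n 0) 0

/-- A code of the rational number `(1 / 2) ^ n`. -/
def codeHalfPow (n : ℕ) : ℕ := Nat.pair (Nat.pair 1 0) (2 ^ n - 1)

/-- The order relation on codes of rational numbers. -/
def codeLE (x y : ℕ) : Prop :=
  x.unpair.1.unpair.1 * (y.unpair.2 + 1) + y.unpair.1.unpair.2 * (x.unpair.2 + 1) ≤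
    y.unpair.1.unpair.1 * (x.unpair.2 + 1) + x.unpair.1.unpair.2 * (y.unpair.2 + 1)

instance : DecidableRel codeLE := fun _ _ => inferInstanceAs (Decidable (_ ≤ _))

/-- Denominators are stored diminished by one; this undoes the shift for a product of denominators.
-/
theorem cast_mul_succ_sub_one (a b : ℕ) :
    (((a + 1) * (b + 1) - 1 : ℕ) : ℚ) + 1 = ((a : ℚ) + 1) * (b + 1) := by
  have : (a + 1) * (b + 1) - 1 + 1 = (a + 1) * (b + 1) := Nat.sub_add_cancel (Nat.succ_le_of_lt (by positivity))
  exact_mod_cast this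

theorem ratNum_codeAdd (x y : ℕ) : ratNum (codeAdd x y) = ratNum x + ratNum y := by
  simp only [ratNum, codeAdd, Nat.unpair_pair, cast_mul_succ_sub_one]
  push_cast
  have h1 : (x.unpair.2 : ℚ) + 1 ≠ 0 := by positivity
  have h2 : (y.unpair.2 : ℚ) + 1 ≠ 0 := by positivity
  field_simp
  ring

theorem ratNum_codeMul (x y : ℕ) : ratNum (codeMul x y) = ratNum x * ratNum y := by
  simp only [ratNum, codeMul, Nat.unpair_pair, cast_mul_succ_sub_one]
  push_cast
  have h1 : (x.unpair.2 : ℚ) + 1 ≠ 0 := by positivity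
  have h2 : (y.unpair.2 : ℚ) + 1 ≠ 0 := by positivity
  field_simp
  ring

theorem ratNum_codeNeg (x : ℕ) : ratNum (codeNeg x) = -ratNum x := by
  simp only [ratNum, codeNeg, Nat.unpair_pair]
  ring

theorem abs_ratNum_le (x : ℕ) : |ratNum x| ≤ ratNum (codeAbs x) := by
  have h : (0 : ℚ) < x.unpair.2 + 1 := by positivity
  simp only [ratNum, codeAbs, Nat.unpair_pair, abs_div, abs_of_pos h]
  gcongr
  rw [abs_le]
  push_cast
  have h1 : (0 : ℚ) ≤ x.unpair.1.unpair.1 := by positivity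
  have h2 : (0 : ℚ) ≤ x.unpair.1.unpair.2 := by positivity
  constructor <;> linarith

@[simp]
theorem ratNum_codeNat (n : ℕ) : ratNum (codeNat n) = n := by simp [ratNum, codeNat]

@[simp]
theorem ratNum_zero : ratNum 0 = 0 := by simp [ratNum]

@[simp]
theorem ratNum_codeHalfPow (n : ℕ) : ratNum (codeHalfPow n) = (1 / 2) ^ n := by
  simp [ratNum, codeHalfPow]

theorem codeLE_iff {x y : ℕ} : codeLE x y ↔ ratNum x ≤ ratNum y := by
  have h1 : (0 : ℚ) < x.unpair.2 + 1 := by positivity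
  have h2 : (0 : ℚ) < y.unpair.2 + 1 := by positivity
  rw [ratNum, ratNum, div_le_div_iff₀ h1 h2, codeLE, ← Nat.cast_le (α := ℚ)]
  push_cast
  constructor <;> intro h <;> linarith

section Primrec

open Primrec

theorem primrec_unpair_fst : Primrec fun n : ℕ => n.unpair.1 := fst.comp unpair

theorem primrec_unpair_snd : Primrec fun n : ℕ => n.unpair.2 := snd.comp unpair

theorem primrec_pow_two : Primrec fun n : ℕ => 2 ^ n := by
  refine (nat_rec₁ 1 (f := fun _ m => 2 * m) (nat_double.comp snd)).of_eq fun n => ?_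
  induction n with
  | zero => rfl
  | succ n ih => simp only [ih]; ring

theorem primrec₂_codeAdd : Primrec₂ codeAdd := by
  have a {f : ℕ × ℕ → ℕ} (hf : Primrec f) : Primrec fun z => (f z).unpair.1.unpair.1 :=
    primrec_unpair_fst.comp (primrec_unpair_fst.comp hf)
  have b {f : ℕ × ℕ → ℕ} (hf : Primrec f) : Primrec fun z => (f z).unpair.1.unpair.2 :=
    primrec_unpair_snd.comp (primrec_unpair_fst.comp hf)
  have c {f : ℕ × ℕ → ℕ} (hf : Primrec f) : Primrec fun z => (f z).unpair.2 + 1 :=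
    succ.comp (primrec_unpair_snd.comp hf)
  exact Primrec₂.natPair.comp (Primrec₂.natPair.comp
      (nat_add.comp (nat_mul.comp (a fst) (c snd)) (nat_mul.comp (a snd) (c fst)))
      (nat_add.comp (nat_mul.comp (b fst) (c snd)) (nat_mul.comp (b snd) (c fst))))
    (nat_sub.comp (nat_mul.comp (c fst) (c snd)) (const 1))

theorem primrec₂_codeMul : Primrec₂ codeMul := by
  have a {f : ℕ × ℕ → ℕ} (hf : Primrec f) : Primrec fun z => (f z).unpair.1.unpair.1 :=
    primrec_unpair_fst.comp (primrec_unpair_fst.comp hf)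
  have b {f : ℕ × ℕ → ℕ} (hf : Primrec f) : Primrec fun z => (f z).unpair.1.unpair.2 :=
    primrec_unpair_snd.comp (primrec_unpair_fst.comp hf)
  have c {f : ℕ × ℕ → ℕ} (hf : Primrec f) : Primrec fun z => (f z).unpair.2 + 1 :=
    succ.comp (primrec_unpair_snd.comp hf)
  exact Primrec₂.natPair.comp (Primrec₂.natPair.comp
      (nat_add.comp (nat_mul.comp (a fst) (a snd)) (nat_mul.comp (b fst) (b snd)))
      (nat_add.comp (nat_mul.comp (a fst) (b snd)) (nat_mul.comp (b fst) (a snd))))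
    (nat_sub.comp (nat_mul.comp (c fst) (c snd)) (const 1))

theorem primrec_codeNeg : Primrec codeNeg :=
  Primrec₂.natPair.comp (Primrec₂.natPair.comp
    (primrec_unpair_snd.comp primrec_unpair_fst) (primrec_unpair_fst.comp primrec_unpair_fst))
    primrec_unpair_snd

theorem primrec_codeAbs : Primrec codeAbs :=
  Primrec₂.natPair.comp (Primrec₂.natPair.comp
    (nat_add.comp (primrec_unpair_fst.comp primrec_unpair_fst)
      (primrec_unpair_snd.comp primrec_unpair_fst)) (const 0)) primrec_unpair_snd

theorem primrec_codeNat : Primrec codeNat :=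
  Primrec₂.natPair.comp (Primrec₂.natPair.comp .id (const 0)) (const 0)

theorem primrec_codeHalfPow : Primrec codeHalfPow :=
  Primrec₂.natPair.comp (const _) (nat_sub.comp primrec_pow_two (const 1))

theorem primrecRel_codeLE : PrimrecRel codeLE := by
  have a {f : ℕ × ℕ → ℕ} (hf : Primrec f) : Primrec fun z => (f z).unpair.1.unpair.1 :=
    primrec_unpair_fst.comp (primrec_unpair_fst.comp hf)
  have b {f : ℕ × ℕ → ℕ} (hf : Primrec f) : Primrec fun z => (f z).unpair.1.unpair.2 :=
    primrec_unpair_snd.comp (primrec_unpair_fst.comp hf)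
  have c {f : ℕ × ℕ → ℕ} (hf : Primrec f) : Primrec fun z => (f z).unpair.2 + 1 :=
    succ.comp (primrec_unpair_snd.comp hf)
  exact nat_le.comp
    (nat_add.comp (nat_mul.comp (a fst) (c snd)) (nat_mul.comp (b snd) (c fst)))
    (nat_add.comp (nat_mul.comp (a snd) (c fst)) (nat_mul.comp (b fst) (c snd)))

end Primrec

/-! ### Reduction of the Uniform Boundedness Theorem to discrete choice -/

/-- The first non-zero answer that the `i`-th associate in the finite oracle prefix `l` gives to
the questions for the digit `n` of the value at the constant sequence `j`. -/
def firstAnswer (l : List ℕ) (i j n : ℕ) : ℕ :=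
  l.getD (Nat.pair i (query n (fun _ => j) ((List.range l.length).findIdx fun h =>
    decide (l.getD (Nat.pair i (query n (fun _ => j) h)) 1 ≠ 0)))) 0

theorem getD_map_range (p : Baire) (N m d : ℕ) :
    ((List.range N).map p).getD m d = if m < N then p m else d := by
  by_cases h : m < N <;> simp [h]

/-- The two defaults in `firstAnswer` make it sound. A question beyond the prefix counts as answered
by `1`, which stops the search there, and its answer is then read as `0`, meaning "not yet known". A
non-zero result therefore comes only from genuine oracle values. -/
theorem exists_of_firstAnswer_ne_zero {p : Baire} {N i j n : ℕ}
    (h : firstAnswer ((List.range N).map p) i j n ≠ 0) :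
    ∃ k, (∀ h < k, p (Nat.pair i (query n (fun _ => j) h)) = 0) ∧
      p (Nat.pair i (query n (fun _ => j) k)) = firstAnswer ((List.range N).map p) i j n := by
  unfold firstAnswer at h ⊢
  set k := (List.range ((List.range N).map p).length).findIdx fun h =>
    decide (((List.range N).map p).getD (Nat.pair i (query n (fun _ => j) h)) 1 ≠ 0) with hk
  refine ⟨k, fun h hlt => ?_, ?_⟩
  · have := List.not_of_lt_findIdx (hk ▸ hlt)
    simp only [List.getElem_range, decide_eq_false_iff_not, not_not, getD_map_range] at this
    split_ifs at this with h1
    exact this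
  · rw [getD_map_range] at h ⊢
    split_ifs at h ⊢ with h1
    · rfl
    · exact absurd rfl h

theorem firstAnswer_eq {p : Baire} {i j n k : ℕ}
    (hk : ∀ h < k, p (Nat.pair i (query n (fun _ => j) h)) = 0)
    (hk' : p (Nat.pair i (query n (fun _ => j) k)) ≠ 0) :
    ∃ N₀, ∀ N ≥ N₀, firstAnswer ((List.range N).map p) i j n =
      p (Nat.pair i (query n (fun _ => j) k)) := by
  -- Long enough for the search to run up to `k` and for the prefix to contain every question asked
  -- on the way.
  refine ⟨k + 1 + ∑ h ∈ Finset.range (k + 1), (Nat.pair i (query n (fun _ => j) h) + 1),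
    fun N hN => ?_⟩
  have hlt : ∀ h ≤ k, Nat.pair i (query n (fun _ => j) h) < N := fun h hh => by
    have := Finset.single_le_sum (f := fun h => Nat.pair i (query n (fun _ => j) h) + 1)
      (fun _ _ => Nat.zero_le _) (Finset.mem_range.mpr (Nat.lt_add_one_of_le hh))
    omega
  have hidx : ((List.range ((List.range N).map p).length).findIdx fun h =>
      decide (((List.range N).map p).getD (Nat.pair i (query n (fun _ => j) h)) 1 ≠ 0)) = k := by
    rw [List.findIdx_eq (by simp; omega)]
    constructor
    · simp only [List.getElem_range, getD_map_range, hlt k le_rfl]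
      simpa using hk'
    · intro h hh
      simp only [List.getElem_range, getD_map_range, hlt h hh.le]
      simpa using hk h hh
  rw [firstAnswer, hidx, getD_map_range, if_pos (hlt k le_rfl)]

section Primrec

open Primrec

theorem primrec_query_const {α : Type*} [Primcodable α] {f g h : α → ℕ} (hf : Primrec f)
    (hg : Primrec g) (hh : Primrec h) : Primrec fun a => query (f a) (fun _ => g a) (h a) :=
  Primrec₂.natPair.comp hf (Primrec.encode.comp
    (list_map (list_range.comp hh) (hg.comp fst)))

theorem primrec_firstAnswer :
    Primrec fun z : List ℕ × ℕ × ℕ × ℕ => firstAnswer z.1 z.2.1 z.2.2.1 z.2.2.2 := by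
  refine (list_getD 0).comp fst (Primrec₂.natPair.comp (fst.comp snd) (primrec_query_const
    (snd.comp (snd.comp snd)) (fst.comp (snd.comp snd)) (list_findIdx
      (list_range.comp (list_length.comp fst)) ?_)))
  have h : Primrec fun z : (List ℕ × ℕ × ℕ × ℕ) × ℕ =>
      z.1.1.getD (Nat.pair z.1.2.1 (query z.1.2.2.2 (fun _ => z.1.2.2.1) z.2)) 1 :=
    (list_getD 1).comp (fst.comp fst) (Primrec₂.natPair.comp (fst.comp (snd.comp fst))
      (primrec_query_const (snd.comp (snd.comp (snd.comp fst)))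
        (fst.comp (snd.comp (snd.comp fst))) snd))
  exact (PrimrecPred.not (Primrec.eq.comp h (const 0))).decide

end Primrec

section

variable {𝕜 : Type*} [RCLike 𝕜] {X : Type*} [NormedAddCommGroup X] [NormedSpace 𝕜 X]

@[simp]
theorem combination_zero (e : ℕ → X) : combination 𝕜 e 0 = 0 := by
  simp [combination]

variable [CompleteSpace X]

/-- The index `0` codes the empty combination, so norms are distances to the point with index `0`.
-/
theorem ComputableBanach.exists_norm_approx (c : ComputableBanach 𝕜 X) :
    ∃ ν : ℕ → ℕ → ℕ, Computable₂ ν ∧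
      ∀ m k, |‖c.metric.pt m‖ - (ratNum (ν m k) : ℝ)| ≤ (1 / 2) ^ k := by
  obtain ⟨f, hf, h⟩ := c.computable_dist
  refine ⟨fun m k => f (m, 0, k), hf.comp (Computable.fst.pair ((Computable.const 0).pair
    Computable.snd)), fun m k => ?_⟩
  have := h m 0 k
  beta_reduce at this
  rwa [combination_zero, dist_zero_right] at this

end

/-- The test whether approximations of `‖x‖` and `‖y‖` of precision `(1 / 2) ^ n` show that
`M * ‖x‖ < ‖z‖` whenever `‖y - z‖ ≤ (1 / 2) ^ n`. -/
def Exceeds (a b M n : ℕ) : Prop :=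
  ¬ codeLE b (codeAdd (codeMul (codeNat M) (codeAdd a (codeHalfPow n)))
    (codeMul (codeNat 2) (codeHalfPow n)))

instance (a b M n : ℕ) : Decidable (Exceeds a b M n) := inferInstanceAs (Decidable (¬ _))

theorem exceeds_iff {a b M n : ℕ} :
    Exceeds a b M n ↔ (M : ℝ) * (ratNum a + (1 / 2) ^ n) + 2 * (1 / 2) ^ n < ratNum b := by
  rw [Exceeds, codeLE_iff, not_le, ← Rat.cast_lt (K := ℝ)]
  simp only [ratNum_codeAdd, ratNum_codeMul, ratNum_codeNat, ratNum_codeHalfPow]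
  push_cast
  rfl

theorem primrec_exceeds : PrimrecPred fun z : (ℕ × ℕ) × ℕ × ℕ =>
    Exceeds z.1.1 z.1.2 z.2.1 z.2.2 := by
  open Primrec in
  have hp : Primrec fun z : (ℕ × ℕ) × ℕ × ℕ => codeHalfPow z.2.2 :=
    primrec_codeHalfPow.comp (snd.comp snd)
  exact PrimrecPred.not (primrecRel_codeLE.comp (snd.comp fst) (primrec₂_codeAdd.comp
    (primrec₂_codeMul.comp (primrec_codeNat.comp (fst.comp snd))
      (primrec₂_codeAdd.comp (fst.comp fst) hp))
    (primrec₂_codeMul.comp (const _) hp)))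

/-- The enumeration of the numbers that do not bound all operator norms. -/
def nonBound (νX νY : ℕ → ℕ → ℕ) (N : ℕ) (l : List ℕ) : ℕ :=
  let z := Denumerable.ofNat (ℕ × ℕ × ℕ × ℕ) N.unpair.2
  let r := firstAnswer l z.2.1 z.2.2.1 z.2.2.2
  if r ≠ 0 ∧ Exceeds (νX z.2.2.1 z.2.2.2) (νY (r - 1) z.2.2.2) z.1 z.2.2.2 then z.1 + 1 else 0

theorem computable₂_nonBound {νX νY : ℕ → ℕ → ℕ} (hX : Computable₂ νX) (hY : Computable₂ νY) :
    Computable₂ (nonBound νX νY) := by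
  have z : Computable fun a : ℕ × List ℕ => Denumerable.ofNat (ℕ × ℕ × ℕ × ℕ) a.1.unpair.2 :=
    (Computable.ofNat _).comp (primrec_unpair_snd.to_comp.comp Computable.fst)
  have z1 := Computable.fst.comp z
  have z2 := Computable.fst.comp (Computable.snd.comp z)
  have z3 := Computable.fst.comp (Computable.snd.comp (Computable.snd.comp z))
  have z4 := Computable.snd.comp (Computable.snd.comp (Computable.snd.comp z))
  have r := primrec_firstAnswer.to_comp.comp (Computable.snd.pair (z2.pair (z3.pair z4)))
  have e := primrec_exceeds.decide.to_comp.comp (((hX.comp z3 z4).pair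
    (hY.comp (Computable.pred.comp r) z4)).pair (z1.pair z4))
  have ne := (PrimrecPred.not (Primrec.eq.comp .id (.const 0))).decide.to_comp.comp r
  have b := Primrec.and.to_comp.comp ne e
  refine (Computable.cond b (Computable.succ.comp z1) (Computable.const 0)).of_eq fun a => ?_
  simp only [nonBound, Bool.cond_eq_ite, Bool.and_eq_true, decide_eq_true_eq, id,
    Nat.pred_eq_sub_one, Nat.succ_eq_add_one]

/-! ### Refuting a bound from finitely many values. -/

section

variable {𝕜 : Type*} [RCLike 𝕜] {X : Type*} [NormedAddCommGroup X] [NormedSpace 𝕜 X]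
  [CompleteSpace X] {Y : Type*} [NormedAddCommGroup Y] [NormedSpace 𝕜 Y]

theorem cauchyName_const {Z : Type*} [MetricSpace Z] (c : ComputableMetric Z) (j : ℕ) :
    CauchyName c (fun _ => j) (c.pt j) :=
  ⟨fun i k _ => by simp, tendsto_const_nhds⟩

/-- The constant sequence `j` is a name of the `j`-th point, so an associate can be evaluated at
dense points without constructing any other names. -/
theorem FunctionName.dist_le {Z W : Type*} [MetricSpace Z] [MetricSpace W]
    {c : ComputableMetric Z} {d : ComputableMetric W} {p : Baire} {T : C(Z, W)}
    (h : FunctionName c d p T) {j n k : ℕ} (hk : ∀ h < k, p (query n (fun _ => j) h) = 0)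
    (hk' : p (query n (fun _ => j) k) ≠ 0) :
    dist (d.pt (p (query n (fun _ => j) k) - 1)) (T (c.pt j)) ≤ (1 / 2) ^ n := by
  obtain ⟨r, hr, hr'⟩ := h _ _ (cauchyName_const c j)
  have := hr'.dist_le n
  obtain ⟨l, hl, hl'⟩ := hr n
  obtain rfl : k = l := by
    rcases lt_trichotomy k l with hkl | rfl | hkl
    · exact absurd (hl k hkl) hk'
    · rfl
    · rw [hk l hkl] at hl'
      omega
  rwa [hl', Nat.add_sub_cancel]

theorem exists_lt_norm_pt (c : ComputableBanach 𝕜 X) (L : X →L[𝕜] Y) {M : ℝ} (hM : 0 ≤ M)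
    (h : M < ‖L‖) : ∃ j, M * ‖c.metric.pt j‖ < ‖L (c.metric.pt j)‖ := by
  by_contra! hcon
  refine absurd (L.opNorm_le_bound hM fun x => ?_) (not_le.mpr h)
  have hcl : IsClosed {x : X | ‖L x‖ ≤ M * ‖x‖} := isClosed_le (by fun_prop) (by fun_prop)
  exact c.metric.dense.induction_on (p := fun x => ‖L x‖ ≤ M * ‖x‖) x hcl hcon

variable [CompleteSpace Y]

/-- From left to right the error margins in `Exceeds` make the test sound. From right to left, a
violated bound is already violated at a dense point, and there a small enough error lets the test
succeed. -/
theorem exists_nonBound_iff {cX : ComputableBanach 𝕜 X} {cY : ComputableBanach 𝕜 Y}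
    {νX νY : ℕ → ℕ → ℕ} (hX : ∀ m k, |‖cX.metric.pt m‖ - (ratNum (νX m k) : ℝ)| ≤ (1 / 2) ^ k)
    (hY : ∀ m k, |‖cY.metric.pt m‖ - (ratNum (νY m k) : ℝ)| ≤ (1 / 2) ^ k) {p : Baire}
    {L : ℕ → X →L[𝕜] Y} {T : ℕ → C(X, Y)} (hLT : ∀ i x, L i x = T i x)
    (hp : (seqRep (functionRep cX.metric cY.metric)).Names p T) (M : ℕ) :
    (∃ N, nonBound νX νY N ((List.range N).map p) = M + 1) ↔ ∃ i, (M : ℝ) < ‖L i‖ := by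
  constructor
  · rintro ⟨N, hN⟩
    unfold nonBound at hN
    set z := Denumerable.ofNat (ℕ × ℕ × ℕ × ℕ) N.unpair.2
    obtain ⟨M', i, j, n⟩ := z
    simp only at hN
    split_ifs at hN with h
    obtain ⟨h1, h2⟩ := h
    obtain rfl : M' = M := by omega
    obtain ⟨k, hk, hk'⟩ := exists_of_firstAnswer_ne_zero h1
    rw [exceeds_iff, ← hk'] at h2
    have h3 := (hp i).dist_le hk (by rw [hk']; exact h1)
    have h4 := abs_le.mp (hX j n)
    have h5 := abs_le.mp (hY (p (Nat.pair i (query n (fun _ => j) k)) - 1) n)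
    refine ⟨i, ?_⟩
    by_contra! hle
    have h6 := (L i).le_of_opNorm_le hle (cX.metric.pt j)
    rw [hLT] at h6
    rw [dist_eq_norm] at h3
    have h7 := norm_sub_norm_le (cY.metric.pt (p (Nat.pair i (query n (fun _ => j) k)) - 1))
      (T i (cX.metric.pt j))
    have h8 : (M' : ℝ) * ‖cX.metric.pt j‖ ≤ M' * (ratNum (νX j n) + (1 / 2) ^ n) := by
      gcongr
      linarith
    linarith
  · rintro ⟨i, hi⟩
    obtain ⟨j, hj⟩ := exists_lt_norm_pt cX (L i) (Nat.cast_nonneg M) hi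
    -- The errors add up to `(2 * M + 4) * (1 / 2) ^ n`: two units multiplied by `M` on the side of
    -- `X`, two margin units in the test, one from the approximate value and one from its
    -- approximate norm.
    obtain ⟨n, hn⟩ := exists_pow_lt_of_lt_one
      (show 0 < (‖L i (cX.metric.pt j)‖ - M * ‖cX.metric.pt j‖) / (2 * M + 4) from
        div_pos (sub_pos.mpr hj) (by positivity)) (by norm_num : (1 / 2 : ℝ) < 1)
    rw [lt_div_iff₀ (by positivity)] at hn
    obtain ⟨r, hr, hr'⟩ := hp i _ _ (cauchyName_const cX.metric j)
    obtain ⟨k, hk, hk'⟩ := hr n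
    beta_reduce at hk hk'
    have hne : p (Nat.pair i (query n (fun _ => j) k)) ≠ 0 := by
      rw [hk']
      omega
    obtain ⟨N₀, hN₀⟩ := firstAnswer_eq hk hne
    -- The first component is padding: it makes the stage, which is also the length of the prefix,
    -- at least `N₀`.
    refine ⟨Nat.pair N₀ (Encodable.encode (M, i, j, n)), ?_⟩
    have hz := hN₀ _ (Nat.left_le_pair N₀ (Encodable.encode (M, i, j, n)))
    have h3 := hr'.dist_le n
    rw [dist_eq_norm, norm_sub_rev] at h3
    have h4 := abs_le.mp (hX j n)
    have h5 := abs_le.mp (hY (r n) n)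
    have h7 := norm_sub_norm_le (T i (cX.metric.pt j)) (cY.metric.pt (r n))
    have h8 : (M : ℝ) * (ratNum (νX j n) + (1 / 2) ^ n) ≤
        M * (‖cX.metric.pt j‖ + (1 / 2) ^ n + (1 / 2) ^ n) := by
      gcongr
      linarith
    rw [hLT] at hn
    have hex : Exceeds (νX j n) (νY (r n) n) M n := by
      rw [exceeds_iff]
      linarith
    simp only [nonBound, Nat.unpair_pair, Denumerable.ofNat_encode, hz, hk', Nat.add_sub_cancel]
    rw [if_pos ⟨by omega, hex⟩]

theorem UBT_reducible_discreteChoice (cX : ComputableBanach 𝕜 X) (cY : ComputableBanach 𝕜 Y) :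
    Reducible (UBT cX cY) discreteChoice := by
  obtain ⟨νX, hνX, hX⟩ := cX.exists_norm_approx
  obtain ⟨νY, hνY, hY⟩ := cY.exists_norm_approx
  -- The odd digits of the interleaving are the answer of choice, which is already a name of the
  -- bound.
  have hH : OracleComputable fun p n => p (2 * n + 1) :=
    OracleComputable.oracle.comp (.of_computable Primrec.nat_double_succ.to_comp)
  have hK := OracleComputable.of_prefix (computable₂_nonBound hνX hνY)
    (OracleComputable.of_computable Computable.id)
  refine ⟨_, _, hH.computableFun, hK.computableFun, fun G hG => ⟨_, ?_, rfl⟩⟩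
  rintro p T hp ⟨hT, hbdd⟩
  let L : ℕ → X →L[𝕜] Y := fun i => (hT i).toContinuousLinearMap
  have hLT : ∀ i x, L i x = T i x := fun i x => rfl
  obtain ⟨C, hC⟩ := banach_steinhaus (g := L) fun x => by
    obtain ⟨C, hC⟩ := hbdd x
    exact ⟨C, fun i => hC ⟨i, rfl⟩⟩
  have hval : ∀ M : ℕ, M ∈ (UBT cX cY).val T ↔ ∀ i, ‖L i‖ ≤ (M : ℝ) := fun M => by
    refine ⟨?_, fun h => ⟨L, hLT, h⟩⟩
    rintro ⟨L', h1, h2⟩ i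
    have : L i = L' i := by
      ext x
      rw [hLT, h1]
    exact this ▸ h2 i
  obtain ⟨g, hg, y, hy, hgy⟩ := hG _ ((UBT cX cY).val T) (fun M => by
    rw [hval, not_forall]
    simp only [not_le]
    exact (exists_nonBound_iff hX hY hLT hp M).symm) (by
      obtain ⟨M, hM⟩ := exists_nat_ge C
      exact ⟨M, (hval M).mpr fun i => (hC i).trans hM⟩)
  refine ⟨fun n => pairing p g (2 * n + 1), ?_, y, hy, fun k => ?_⟩
  · simp only [composite, Part.bind_some, Part.mem_bind_iff]
    exact ⟨g, hg, Part.mem_some _⟩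
  · have h1 : (2 * k + 1) % 2 ≠ 0 := by omega
    have h2 : (2 * k + 1) / 2 = k := by omega
    simp only [pairing, h1, if_false, h2]
    exact hgy k

end

/-! ### Computability of bounded quantifiers and of searches -/

theorem computable_forall_lt {α : Type*} [Primcodable α] {p : α → ℕ → Prop}
    [∀ a n, Decidable (p a n)] (hp : Computable₂ fun a n => decide (p a n)) {b : α → ℕ}
    (hb : Computable b) : Computable fun a => decide (∀ n < b a, p a n) := by
  have h := Computable.nat_rec (h := fun a (z : ℕ × Bool) => decide (p a z.1) && z.2) hb
    (Computable.const true) (Primrec.and.to_comp.comp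
      (hp.comp Computable.fst (Computable.fst.comp Computable.snd))
      (Computable.snd.comp Computable.snd))
  refine h.of_eq fun a => ?_
  induction b a with
  | zero => simp
  | succ n ih =>
    simp only [ih]
    rw [Bool.eq_iff_iff]
    simp only [Bool.and_eq_true, decide_eq_true_eq]
    constructor
    · rintro ⟨h1, h2⟩ m hm
      rcases Nat.lt_succ_iff_lt_or_eq.mp hm with h | rfl
      · exact h2 m h
      · exact h1
    · exact fun h => ⟨h n (Nat.lt_succ_self n), fun m hm => h m (hm.trans (Nat.lt_succ_self n))⟩

/-- The invariant `P` guarantees that the unbounded search for a successor terminates at every step,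
so iterating it gives a total function. -/
theorem exists_computable_seq {R : ℕ → ℕ → ℕ → Prop} [∀ t a b, Decidable (R t a b)]
    (hR : Computable fun z : (ℕ × ℕ) × ℕ => decide (R z.1.1 z.1.2 z.2)) {P : ℕ → ℕ → Prop}
    {a₀ : ℕ} (h₀ : P 0 a₀) (hex : ∀ t a, P t a → ∃ b, R t a b)
    (hP : ∀ t a b, P t a → R t a b → P (t + 1) b) :
    ∃ G : ℕ → ℕ, Computable G ∧ G 0 = a₀ ∧ (∀ t, P t (G t)) ∧ ∀ t, R t (G t) (G (t + 1)) := by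
  classical
  let S : ℕ × ℕ →. ℕ := fun z => Nat.rfind fun b => Part.some (decide (R z.1 z.2 b))
  have hS : Partrec S := Partrec.rfind (Computable.partrec hR)
  have hrec := Partrec.nat_rec (f := fun t : ℕ => t) (g := fun _ : ℕ => Part.some a₀)
    (h := fun (_ : ℕ) z => S z) Computable.id (Computable.const a₀)
    (hS.comp Computable.snd)
  have hspec : ∀ t a, P t a → ∃ b, b ∈ S (t, a) ∧ R t a b := by
    intro t a hta
    obtain ⟨b, hb⟩ := hex t a hta
    obtain ⟨c, hc, -⟩ := Nat.rfind_min' (p := fun b => decide (R t a b)) (m := b) (by simpa using hb)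
    exact ⟨c, hc, by simpa using Nat.rfind_spec hc⟩
  choose! b hb hRb using hspec
  let G : ℕ → ℕ := fun t => t.rec a₀ fun t a => b t a
  have hG : ∀ t, P t (G t) := fun t => by
    induction t with
    | zero => exact h₀
    | succ t ih => exact hP t _ _ ih (hRb t _ ih)
  refine ⟨G, hrec.of_eq_tot fun t => ?_, rfl, hG, fun t => hRb t _ (hG t)⟩
  induction t with
  | zero => exact Part.mem_some _
  | succ t ih => exact Part.mem_bind ih (hb t _ (hG t))

/-! ### Functionals with approximately given values -/

section

variable {E : Type*} [NormedAddCommGroup E] [NormedSpace ℝ E]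

/-- Hahn–Banach on `E × V` for the sublinear functional `‖y‖ + q l`. On the graph of `f` the
functional `(f l, l) ↦ a l` is dominated by it. The extension restricted to `E` is `u`, and its
restriction to `V`, dominated by `q`, is the error. -/
theorem exists_functional_approx {V : Type*} [AddCommGroup V] [Module ℝ V] (f : V →ₗ[ℝ] E)
    (a : V →ₗ[ℝ] ℝ) (q : Seminorm ℝ V) (h : ∀ l, a l ≤ ‖f l‖ + q l) :
    ∃ u : StrongDual ℝ E, (∀ y, |u y| ≤ ‖y‖) ∧ ∀ l, |u (f l) - a l| ≤ q l := by
  let N : E × V → ℝ := fun z => ‖z.1‖ + q z.2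
  let D : Submodule ℝ (E × V) := LinearMap.range (f.prod LinearMap.id)
  obtain ⟨g, hg, hgN⟩ := exists_extension_of_le_sublinear
    (⟨D, a ∘ₗ LinearMap.snd ℝ E V ∘ₗ D.subtype⟩ : (E × V) →ₗ.[ℝ] ℝ) N
    (fun c hc z => by
      simp only [N, Prod.smul_fst, Prod.smul_snd, norm_smul, map_smul_eq_mul, Real.norm_eq_abs,
        abs_of_pos hc]
      ring)
    (fun z z' => by
      have h1 := norm_add_le z.1 z'.1
      have h2 := map_add_le_add q z.2 z'.2
      simp only [N, Prod.fst_add, Prod.snd_add]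
      linarith)
    (by
      rintro ⟨_, l, rfl⟩
      exact h l)
  have habs : ∀ z, |g z| ≤ N z := fun z => abs_le.mpr ⟨by
    have := hgN (-z)
    simp only [map_neg, N, Prod.fst_neg, Prod.snd_neg, norm_neg, map_neg_eq_map] at this
    linarith, hgN z⟩
  have hu : ∀ y, |(g ∘ₗ LinearMap.inl ℝ E V) y| ≤ ‖y‖ := fun y => by
    simpa [N] using habs (y, 0)
  refine ⟨(g ∘ₗ LinearMap.inl ℝ E V).mkContinuous 1 fun y => by simpa using hu y, hu, fun l => ?_⟩
  have h1 : g (f l, l) = a l := hg ⟨(f l, l), l, rfl⟩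
  have h2 : g (f l, l) = g (f l, 0) + g (0, l) := by
    rw [← map_add]
    simp
  have h3 := habs (0, l)
  simp only [N, norm_zero, zero_add] at h3
  have h4 : g (f l, 0) - a l = -g (0, l) := by
    rw [← h1, h2]
    ring
  change |g (f l, 0) - a l| ≤ q l
  rwa [h4, abs_neg]

/-- A Helly-type criterion: with the seminorm `η` times the `ℓ¹` norm, the error at each unit vector
is at most `η`. -/
theorem exists_functional_of_sum_le {ι : Type*} [Fintype ι] (x : ι → E) (a : ι → ℝ) {η : ℝ}
    (hη : 0 ≤ η) (h : ∀ l : ι → ℝ, ∑ i, l i * a i ≤ ‖∑ i, l i • x i‖ + η * ∑ i, |l i|) :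
    ∃ u : StrongDual ℝ E, (∀ y, |u y| ≤ ‖y‖) ∧ ∀ i, |u (x i) - a i| ≤ η := by
  classical
  let q : Seminorm ℝ (ι → ℝ) := Seminorm.of (fun l => η * ∑ i, |l i|)
    (fun l l' => by
      rw [← mul_add, ← Finset.sum_add_distrib]
      exact mul_le_mul_of_nonneg_left (Finset.sum_le_sum fun i _ => abs_add_le _ _) hη)
    (fun c l => by
      simp only [Pi.smul_apply, smul_eq_mul, abs_mul, ← Finset.mul_sum, Real.norm_eq_abs]
      ring)
  obtain ⟨u, hu, hq⟩ := exists_functional_approx (Fintype.linearCombination ℝ x)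
    (Fintype.linearCombination ℝ a) q h
  refine ⟨u, hu, fun i => ?_⟩
  have hi : q (Pi.single i 1) = η := by
    change η * ∑ j, |(Pi.single i 1 : ι → ℝ) j| = η
    rw [Finset.sum_eq_single i (fun j _ hj => by simp [hj]) (by simp)]
    simp
  simpa [Fintype.linearCombination_apply_single, hi] using hq (Pi.single i 1)

/-- The desired inequality is homogeneous, so a non-zero `l` can be scaled until its largest
coefficient has absolute value `N` and then rounded down to integers. The rounding errors and the
constant `2 * δ` are bounded independently of `l`; by `hN` they total at most `δ * N`, and hence at
most `δ` times the `ℓ¹` norm of the scaled vector. -/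
theorem sum_le_norm_of_int {ι : Type*} [Fintype ι] (x : ι → E) (a : ι → ℝ) {δ : ℝ} (hδ : 0 < δ)
    {N : ℕ} (hN : ∑ i, ‖x i‖ + ∑ i, |a i| + δ * (Fintype.card ι + 2) ≤ δ * N)
    (h : ∀ k : ι → ℤ, (∀ i, |k i| ≤ N) →
      ∑ i, (k i : ℝ) * a i ≤ ‖∑ i, (k i : ℝ) • x i‖ + 2 * δ + δ * ∑ i, |(k i : ℝ)|)
    (l : ι → ℝ) : ∑ i, l i * a i ≤ ‖∑ i, l i • x i‖ + 2 * δ * ∑ i, |l i| := by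
  by_cases hl : l = 0
  · simp [hl]
  obtain ⟨i₁, hi₁⟩ := Function.ne_iff.mp hl
  obtain ⟨i₀, -, hmax⟩ := Finset.exists_max_image Finset.univ (fun i => |l i|) ⟨i₁, Finset.mem_univ _⟩
  have hM : 0 < |l i₀| := (abs_pos.mpr hi₁).trans_le (hmax i₁ (Finset.mem_univ _))
  have hN0 : (0 : ℝ) < N := by
    have h1 : 0 ≤ ∑ i, ‖x i‖ := Finset.sum_nonneg fun _ _ => norm_nonneg _
    have h2 : 0 ≤ ∑ i, |a i| := Finset.sum_nonneg fun _ _ => abs_nonneg _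
    have h3 : 0 < δ * (Fintype.card ι + 2) := by positivity
    exact pos_of_mul_pos_right (by linarith) hδ.le
  set t : ℝ := N / |l i₀| with ht
  have ht0 : 0 < t := div_pos hN0 hM
  have hle : ∀ i, |t * l i| ≤ N := fun i => by
    rw [abs_mul, abs_of_pos ht0, ht, div_mul_eq_mul_div, div_le_iff₀ hM]
    exact mul_le_mul_of_nonneg_left (hmax i (Finset.mem_univ _)) hN0.le
  have heq : |t * l i₀| = N := by
    rw [abs_mul, abs_of_pos ht0, ht, div_mul_cancel₀ _ hM.ne']
  let k : ι → ℤ := fun i => ⌊t * l i⌋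
  have hk : ∀ i, |(k i : ℝ) - t * l i| ≤ 1 := fun i => by
    rw [abs_le]
    constructor <;> linarith [Int.floor_le (t * l i), Int.lt_floor_add_one (t * l i)]
  have hkN : ∀ i, |k i| ≤ N := fun i => by
    obtain ⟨h1, h2⟩ := abs_le.mp (hle i)
    refine abs_le.mpr ⟨Int.le_floor.mpr (by push_cast; exact h1), ?_⟩
    have := (Int.floor_le (t * l i)).trans h2
    exact_mod_cast this
  have h1 := h k hkN
  have h2 : ∑ i, t * l i * a i ≤ ∑ i, (k i : ℝ) * a i + ∑ i, |a i| := by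
    rw [← Finset.sum_add_distrib]
    refine Finset.sum_le_sum fun i _ => ?_
    have h3 : |((k i : ℝ) - t * l i) * a i| ≤ |a i| := by
      rw [abs_mul]
      exact mul_le_of_le_one_left (abs_nonneg _) (hk i)
    have := (abs_le.mp h3).1
    linarith
  have h3 : ‖∑ i, (k i : ℝ) • x i‖ ≤ ‖∑ i, (t * l i) • x i‖ + ∑ i, ‖x i‖ := by
    have h4 : ∑ i, (k i : ℝ) • x i = ∑ i, (t * l i) • x i + ∑ i, ((k i : ℝ) - t * l i) • x i := by
      rw [← Finset.sum_add_distrib]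
      refine Finset.sum_congr rfl fun i _ => ?_
      rw [← add_smul]
      ring_nf
    rw [h4]
    refine (norm_add_le _ _).trans (add_le_add_right ((norm_sum_le _ _).trans
      (Finset.sum_le_sum fun i _ => ?_)) _)
    rw [norm_smul, Real.norm_eq_abs]
    exact mul_le_of_le_one_left (norm_nonneg _) (hk i)
  have h4 : ∑ i, |(k i : ℝ)| ≤ ∑ i, |t * l i| + Fintype.card ι := by
    have : (Fintype.card ι : ℝ) = ∑ _i : ι, (1 : ℝ) := by simp
    rw [this, ← Finset.sum_add_distrib]
    refine Finset.sum_le_sum fun i _ => ?_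
    have := abs_sub_abs_le_abs_sub (k i : ℝ) (t * l i)
    linarith [hk i]
  have h5 : (N : ℝ) ≤ ∑ i, |t * l i| :=
    heq ▸ Finset.single_le_sum (f := fun i => |t * l i|) (fun _ _ => abs_nonneg _)
      (Finset.mem_univ i₀)
  have h6 : ∑ i, t * l i * a i = t * ∑ i, l i * a i := by
    rw [Finset.mul_sum]
    exact Finset.sum_congr rfl fun i _ => by ring
  have h7 : ‖∑ i, (t * l i) • x i‖ = t * ‖∑ i, l i • x i‖ := by
    simp only [mul_smul, ← Finset.smul_sum]
    rw [norm_smul, Real.norm_eq_abs, abs_of_pos ht0]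
  have h8 : ∑ i, |t * l i| = t * ∑ i, |l i| := by
    rw [Finset.mul_sum]
    exact Finset.sum_congr rfl fun i _ => by rw [abs_mul, abs_of_pos ht0]
  rw [h6] at h2
  rw [h7] at h3
  have h9 := mul_le_mul_of_nonneg_left h5 hδ.le
  have h10 := mul_le_mul_of_nonneg_left h4 hδ.le
  rw [h8] at h9 h10
  refine le_of_mul_le_mul_left ?_ ht0
  linarith

end

/-! ### Rational linear combinations on codes -/

/-- The sum `∑ i < n, f i` on codes of rational numbers. -/
def codeSum (f : ℕ → ℕ) (n : ℕ) : ℕ := n.rec 0 fun i s => codeAdd s (f i)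

theorem ratNum_codeSum (f : ℕ → ℕ) (n : ℕ) :
    ratNum (codeSum f n) = ∑ i ∈ Finset.range n, ratNum (f i) := by
  induction n with
  | zero => simp [codeSum]
  | succ n ih => rw [Finset.sum_range_succ, ← ih, ← ratNum_codeAdd, codeSum, codeSum]

/-- The rational real part of the `i`-th entry of a list of codes of scalars. -/
def reAt (w : List ℕ) (i : ℕ) : ℝ := ratNum (w.getD i 0).unpair.1

/-- The rational imaginary part of the `i`-th entry of a list of codes of scalars. -/
def imAt (w : List ℕ) (i : ℕ) : ℝ := ratNum (w.getD i 0).unpair.2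

/-- The real dot product of the first `n` entries of two lists of codes of scalars. -/
def codeDot (w A : List ℕ) (n : ℕ) : ℕ :=
  codeSum (fun i => codeAdd (codeMul (w.getD i 0).unpair.1 (A.getD i 0).unpair.1)
    (codeMul (w.getD i 0).unpair.2 (A.getD i 0).unpair.2)) n

/-- An upper bound for the sum of the absolute values of the real and imaginary parts. -/
def codeNorm (w : List ℕ) (n : ℕ) : ℕ :=
  codeSum (fun i => codeAdd (codeAbs (w.getD i 0).unpair.1) (codeAbs (w.getD i 0).unpair.2)) n

theorem ratNum_codeDot (w A : List ℕ) (n : ℕ) : (ratNum (codeDot w A n) : ℝ) =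
    ∑ i ∈ Finset.range n, (reAt w i * reAt A i + imAt w i * imAt A i) := by
  rw [codeDot, ratNum_codeSum]
  push_cast [ratNum_codeAdd, ratNum_codeMul]
  rfl

theorem sum_abs_le_codeNorm (w : List ℕ) (n : ℕ) :
    ∑ i ∈ Finset.range n, (|reAt w i| + |imAt w i|) ≤ (ratNum (codeNorm w n) : ℝ) := by
  rw [codeNorm, ratNum_codeSum]
  push_cast [ratNum_codeAdd]
  refine Finset.sum_le_sum fun i _ => add_le_add ?_ ?_
  · have := abs_ratNum_le (w.getD i 0).unpair.1
    rw [reAt]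
    exact_mod_cast this
  · have := abs_ratNum_le (w.getD i 0).unpair.2
    rw [imAt]
    exact_mod_cast this

/-- Gives an integer upper bound that can be read off a code without division. -/
theorem ratNum_le_numerator (x : ℕ) : ratNum x ≤ x.unpair.1.unpair.1 := by
  rw [ratNum, div_le_iff₀ (by positivity)]
  have h1 : (0 : ℚ) ≤ x.unpair.1.unpair.1 := by positivity
  have h2 : (0 : ℚ) ≤ x.unpair.1.unpair.2 := by positivity
  have h3 : (0 : ℚ) ≤ x.unpair.2 := by positivity
  nlinarith [mul_nonneg h1 h3]

theorem ratNum_le_numerator' (x : ℕ) : (ratNum x : ℝ) ≤ (x.unpair.1.unpair.1 : ℝ) := by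
  exact_mod_cast ratNum_le_numerator x

section Computable

open Computable

variable {α : Type*} [Primcodable α]

theorem computable_codeSum {f : α → ℕ → ℕ} (hf : Computable₂ f) {n : α → ℕ} (hn : Computable n) :
    Computable fun a => codeSum (f a) (n a) := by
  have h : Computable fun z : α × ℕ × ℕ => codeAdd z.2.2 (f z.1 z.2.1) :=
    primrec₂_codeAdd.to_comp.comp (snd.comp snd) (hf.comp fst (fst.comp snd))
  exact nat_rec hn (const 0) h.to₂

theorem computable_entry {w : α → List ℕ} (hw : Computable w) :
    Computable fun z : α × ℕ => (w z.1).getD z.2 0 :=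
  (Primrec.list_getD 0).to_comp.comp (hw.comp fst) snd

theorem computable_codeDot {w A : α → List ℕ} {n : α → ℕ} (hw : Computable w) (hA : Computable A)
    (hn : Computable n) : Computable fun a => codeDot (w a) (A a) (n a) := by
  have h := computable_entry hw
  have h' := computable_entry hA
  have hs := primrec₂_codeAdd.to_comp.comp
    (primrec₂_codeMul.to_comp.comp (primrec_unpair_fst.to_comp.comp h)
      (primrec_unpair_fst.to_comp.comp h'))
    (primrec₂_codeMul.to_comp.comp (primrec_unpair_snd.to_comp.comp h)
      (primrec_unpair_snd.to_comp.comp h'))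
  exact computable_codeSum hs.to₂ hn

theorem computable_codeNorm {w : α → List ℕ} {n : α → ℕ} (hw : Computable w)
    (hn : Computable n) : Computable fun a => codeNorm (w a) (n a) := by
  have h := computable_entry hw
  have hs := primrec₂_codeAdd.to_comp.comp
    (primrec_codeAbs.to_comp.comp (primrec_unpair_fst.to_comp.comp h))
    (primrec_codeAbs.to_comp.comp (primrec_unpair_snd.to_comp.comp h))
  exact computable_codeSum hs.to₂ hn

end Computable

/-- The code of the multiple by the scalar with code `z` of the `i`-th vector. -/
def multipleCode (i z : ℕ) : ℕ := Encodable.encode ((List.range i).map (fun _ => 0) ++ [z])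

theorem primrec₂_multipleCode : Primrec₂ multipleCode :=
  Primrec.encode.comp (Primrec.list_concat.comp
    (Primrec.list_map (Primrec.list_range.comp Primrec.fst) (Primrec.const 0).to₂) Primrec.snd)

theorem pair_le_pair {a b c d : ℕ} (h : a ≤ c) (h' : b ≤ d) : Nat.pair a b ≤ Nat.pair c d := by
  rcases h.lt_or_eq with h4 | rfl <;> rcases h'.lt_or_eq with h5 | rfl
  · exact ((Nat.pair_lt_pair_left _ h4).trans (Nat.pair_lt_pair_right _ h5)).le
  · exact (Nat.pair_lt_pair_left _ h4).le
  · exact (Nat.pair_lt_pair_right _ h5).le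
  · exact le_rfl

/-- An upper bound for the codes of lists of length at most `n` with entries at most `b`. -/
def listBound (n b : ℕ) : ℕ := n.rec 0 fun _ c => Nat.pair b c + 1

theorem encode_le_listBound {b : ℕ} : ∀ {l : List ℕ}, (∀ x ∈ l, x ≤ b) →
    Encodable.encode l ≤ listBound l.length b
  | [], _ => by simp
  | x :: l, h => by
    have h1 := encode_le_listBound (l := l) fun y hy => h y (List.mem_cons_of_mem _ hy)
    rw [Encodable.encode_list_cons, List.length_cons]
    exact Nat.succ_le_succ (pair_le_pair (h x List.mem_cons_self) h1)

/-- A code of the integer `k`. -/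
def codeInt (k : ℤ) : ℕ := Nat.pair (Nat.pair k.toNat (-k).toNat) 0

@[simp]
theorem ratNum_codeInt (k : ℤ) : ratNum (codeInt k) = k := by
  have := Int.toNat_sub_toNat_neg k
  simp only [ratNum, codeInt, Nat.unpair_pair, Nat.cast_zero, zero_add, div_one]
  exact_mod_cast this

theorem ratNum_codeAbs_codeInt (k : ℤ) : ratNum (codeAbs (codeInt k)) = |(k : ℚ)| := by
  have : ((k.toNat : ℤ) + ((-k).toNat : ℤ)) = |k| := by
    rcases abs_cases k with h | h <;> omega
  simp only [ratNum, codeAbs, codeInt, Nat.unpair_pair, Nat.cast_zero, zero_add, div_one, sub_zero]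
  exact_mod_cast this

theorem codeInt_le {k : ℤ} {N : ℕ} (h : |k| ≤ N) :
    codeInt k ≤ Nat.pair (Nat.pair N N) 0 := by
  have := abs_le.mp h
  exact pair_le_pair (pair_le_pair (by omega) (by omega)) le_rfl

/-! ### Finite approximations of functionals -/

/-- The numbers that the coefficients of combinations have to exceed for a test of precision
`(1 / 2) ^ s` of the values `A` on the first `s` vectors. -/
def gridBound (ν : ℕ → ℕ → ℕ) (s : ℕ) (A : List ℕ) : ℕ :=
  2 ^ s * ((codeNorm A s).unpair.1.unpair.1 + 2 * (codeSum (fun i => codeAdd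
    (ν (multipleCode i (Nat.pair (codeNat 1) 0)) 0) (codeNat 1)) s).unpair.1.unpair.1) + 2 * s + 2

/-- The codes of the linear combinations on which the values `A` are tested are below this. -/
def testBound (ν : ℕ → ℕ → ℕ) (s : ℕ) (A : List ℕ) : ℕ :=
  listBound s (Nat.pair (Nat.pair (Nat.pair (gridBound ν s A) (gridBound ν s A)) 0)
    (Nat.pair (Nat.pair (gridBound ν s A) (gridBound ν s A)) 0)) + 1

/-- The test whether the functional with the values `A` on the first vectors is bounded by the
norm, up to precision `(1 / 2) ^ s`, at the linear combination with coefficients `w`. -/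
def Passes (s : ℕ) (A w : List ℕ) (b : ℕ) : Prop :=
  s < w.length ∨ codeLE (codeDot w A w.length) (codeAdd b (codeAdd (codeHalfPow s)
    (codeMul (codeHalfPow s) (codeNorm w w.length))))

instance (s : ℕ) (A w : List ℕ) (b : ℕ) : Decidable (Passes s A w b) :=
  inferInstanceAs (Decidable (_ ∨ _))

/-- The values `A` on the first `s` vectors belong to a functional of norm at most one, up to
precision `(1 / 2) ^ s`. -/
def Admissible (ν : ℕ → ℕ → ℕ) (s : ℕ) (A : List ℕ) : Prop :=
  ∀ m < testBound ν s A, Passes s A (Denumerable.ofNat (List ℕ) m) (ν m s)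

instance (ν : ℕ → ℕ → ℕ) (s : ℕ) (A : List ℕ) : Decidable (Admissible ν s A) :=
  inferInstanceAs (Decidable (∀ m < _, _))

/-- The first `s` values of `A` and `A'` differ by at most `3 * (1 / 2) ^ s`. -/
def Near (s : ℕ) (A A' : List ℕ) : Prop :=
  ∀ i < s, (codeLE (A.getD i 0).unpair.1
      (codeAdd (A'.getD i 0).unpair.1 (codeMul (codeNat 3) (codeHalfPow s))) ∧
    codeLE (A'.getD i 0).unpair.1
      (codeAdd (A.getD i 0).unpair.1 (codeMul (codeNat 3) (codeHalfPow s)))) ∧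
    codeLE (A.getD i 0).unpair.2
      (codeAdd (A'.getD i 0).unpair.2 (codeMul (codeNat 3) (codeHalfPow s))) ∧
    codeLE (A'.getD i 0).unpair.2
      (codeAdd (A.getD i 0).unpair.2 (codeMul (codeNat 3) (codeHalfPow s)))

instance (s : ℕ) (A A' : List ℕ) : Decidable (Near s A A') :=
  inferInstanceAs (Decidable (∀ i < _, _))

theorem codeLE_iff_real {x y : ℕ} : codeLE x y ↔ (ratNum x : ℝ) ≤ ratNum y := by
  rw [codeLE_iff, Rat.cast_le]

theorem near_iff {s : ℕ} {A A' : List ℕ} : Near s A A' ↔ ∀ i < s,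
    |reAt A i - reAt A' i| ≤ 3 * (1 / 2) ^ s ∧ |imAt A i - imAt A' i| ≤ 3 * (1 / 2) ^ s := by
  have h (x y : ℕ) : codeLE x (codeAdd y (codeMul (codeNat 3) (codeHalfPow s))) ∧
      codeLE y (codeAdd x (codeMul (codeNat 3) (codeHalfPow s))) ↔
      |(ratNum x : ℝ) - ratNum y| ≤ 3 * (1 / 2) ^ s := by
    simp only [codeLE_iff_real, ratNum_codeAdd, ratNum_codeMul, ratNum_codeNat,
      ratNum_codeHalfPow, abs_le]
    push_cast
    constructor <;> rintro ⟨h1, h2⟩ <;> constructor <;> linarith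
  simp only [Near, h, reAt, imAt]

section Computable

open Computable

variable {α : Type*} [Primcodable α]

theorem computable_gridBound {ν : ℕ → ℕ → ℕ} (hν : Computable₂ ν) {s : α → ℕ} {A : α → List ℕ}
    (hs : Computable s) (hA : Computable A) : Computable fun a => gridBound ν (s a) (A a) := by
  have num := (primrec_unpair_fst.comp primrec_unpair_fst).to_comp
  have hunit : Computable fun i : ℕ => multipleCode i (Nat.pair (codeNat 1) 0) :=
    primrec₂_multipleCode.to_comp.comp .id (const _)
  have hterm : Computable fun z : α × ℕ =>
      codeAdd (ν (multipleCode z.2 (Nat.pair (codeNat 1) 0)) 0) (codeNat 1) :=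
    primrec₂_codeAdd.to_comp.comp (hν.comp (hunit.comp snd) (const 0)) (const _)
  have hsum := computable_codeSum hterm.to₂ hs
  have add := Primrec.nat_add.to_comp
  have mul := Primrec.nat_mul.to_comp
  exact add.comp (add.comp (mul.comp (primrec_pow_two.to_comp.comp hs)
    (add.comp (num.comp (computable_codeNorm hA hs)) (mul.comp (const 2) (num.comp hsum))))
    (mul.comp (const 2) hs)) (const 2)

theorem computable_testBound {ν : ℕ → ℕ → ℕ} (hν : Computable₂ ν) {s : α → ℕ} {A : α → List ℕ}
    (hs : Computable s) (hA : Computable A) : Computable fun a => testBound ν (s a) (A a) := by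
  have hg := computable_gridBound hν hs hA
  have pr := Primrec₂.natPair.to_comp
  have h1 := pr.comp (pr.comp hg hg) (const 0)
  have h2 := succ.comp (pr.comp ((pr.comp h1 h1).comp fst) (snd.comp (snd (α := α) (β := ℕ × ℕ))))
  exact succ.comp (nat_rec hs (const 0) h2.to₂)

theorem computable_passes {s b : α → ℕ} {A w : α → List ℕ} (hs : Computable s)
    (hA : Computable A) (hw : Computable w) (hb : Computable b) :
    Computable fun a => decide (Passes (s a) (A a) (w a) (b a)) := by
  have hl := list_length.comp hw
  have hp := primrec_codeHalfPow.to_comp.comp hs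
  have add := primrec₂_codeAdd.to_comp
  have h1 := Primrec.nat_lt.decide.to_comp.comp hs hl
  have h2 := primrecRel_codeLE.decide.to_comp.comp (computable_codeDot hw hA hl)
    (add.comp hb (add.comp hp (primrec₂_codeMul.to_comp.comp hp (computable_codeNorm hw hl))))
  exact (Primrec.or.to_comp.comp h1 h2).of_eq fun a => (Bool.decide_or _ _).symm

theorem computable_admissible {ν : ℕ → ℕ → ℕ} (hν : Computable₂ ν) {s : α → ℕ} {A : α → List ℕ}
    (hs : Computable s) (hA : Computable A) :
    Computable fun a => decide (Admissible ν (s a) (A a)) := by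
  have hp := computable_passes (α := α × ℕ) (hs.comp fst) (hA.comp fst)
    ((Computable.ofNat (List ℕ)).comp snd) (hν.comp snd (hs.comp fst))
  exact computable_forall_lt hp.to₂ (computable_testBound hν hs hA)

theorem computable_near {s : α → ℕ} {A A' : α → List ℕ} (hs : Computable s) (hA : Computable A)
    (hA' : Computable A') : Computable fun a => decide (Near (s a) (A a) (A' a)) := by
  have h := computable_entry hA
  have h' := computable_entry hA'
  have le {x y : α × ℕ → ℕ} (hx : Computable x) (hy : Computable y) :=
    primrecRel_codeLE.decide.to_comp.comp hx (primrec₂_codeAdd.to_comp.comp hy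
      (primrec₂_codeMul.to_comp.comp (const (codeNat 3))
        (primrec_codeHalfPow.to_comp.comp (hs.comp fst))))
  have f := primrec_unpair_fst.to_comp
  have g := primrec_unpair_snd.to_comp
  have and := Primrec.and.to_comp
  have hall := and.comp (and.comp (le (f.comp h) (f.comp h')) (le (f.comp h') (f.comp h)))
    (and.comp (le (g.comp h) (g.comp h')) (le (g.comp h') (g.comp h)))
  simp only [← Bool.decide_and] at hall
  exact computable_forall_lt hall.to₂ hs

end Computable

/-! ### Passing the test versus approximating a functional. -/

section

variable {𝕜 : Type*} [RCLike 𝕜] {X : Type*} [NormedAddCommGroup X] [NormedSpace 𝕜 X]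

theorem combination_multipleCode (e : ℕ → X) (i z : ℕ) :
    combination 𝕜 e (multipleCode i z) = scalarNum 𝕜 z • e i := by
  have h0 : scalarNum 𝕜 0 = 0 := by simp [scalarNum]
  rw [combination, multipleCode, Denumerable.ofNat_encode, List.length_append, List.length_map,
    List.length_range, List.length_singleton, Finset.sum_range_succ, Finset.sum_eq_zero, zero_add]
  · simp
  · intro j hj
    have := Finset.mem_range.mp hj
    simp [List.getElem?_append, this, h0]

variable [NormedSpace ℝ X] [IsScalarTower ℝ 𝕜 X]

theorem combination_encode (e : ℕ → X) (w : List ℕ) : combination 𝕜 e (Encodable.encode w) =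
    ∑ i ∈ Finset.range w.length, (reAt w i • e i + imAt w i • (RCLike.I : 𝕜) • e i) := by
  rw [combination, Denumerable.ofNat_encode]
  refine Finset.sum_congr rfl fun i _ => ?_
  rw [scalarNum, add_smul, mul_smul, reAt, imAt, RCLike.real_smul_eq_coe_smul (K := 𝕜),
    RCLike.real_smul_eq_coe_smul (K := 𝕜), RCLike.ofReal_ratCast, RCLike.ofReal_ratCast]

/-- The first `s` entries of `A` approximate the values of the real functional `u` at `e i` and
`I • e i` up to `ε`. -/
def Approximates (𝕜 : Type*) [RCLike 𝕜] [NormedSpace 𝕜 X] (e : ℕ → X) (u : StrongDual ℝ X)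
    (A : List ℕ) (s : ℕ) (ε : ℝ) : Prop :=
  ∀ i < s, |reAt A i - u (e i)| ≤ ε ∧ |imAt A i - u ((RCLike.I : 𝕜) • e i)| ≤ ε

theorem Approximates.dot {e : ℕ → X} {u : StrongDual ℝ X} {A : List ℕ} {s : ℕ} {ε : ℝ}
    (h : Approximates 𝕜 e u A s ε) {w : List ℕ} (hw : w.length ≤ s) (hε : 0 ≤ ε) :
    |(ratNum (codeDot w A w.length) : ℝ) - u (combination 𝕜 e (Encodable.encode w))| ≤
      ε * ratNum (codeNorm w w.length) := by
  rw [ratNum_codeDot, combination_encode, map_sum, ← Finset.sum_sub_distrib]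
  refine (Finset.abs_sum_le_sum_abs _ _).trans
    (le_trans ?_ (mul_le_mul_of_nonneg_left (sum_abs_le_codeNorm w w.length) hε))
  rw [Finset.mul_sum]
  refine Finset.sum_le_sum fun i hi => ?_
  obtain ⟨h1, h2⟩ := h i ((Finset.mem_range.mp hi).trans_le hw)
  rw [map_add, map_smul, map_smul, smul_eq_mul, smul_eq_mul]
  have h3 : reAt w i * reAt A i + imAt w i * imAt A i -
      (reAt w i * u (e i) + imAt w i * u ((RCLike.I : 𝕜) • e i)) =
      reAt w i * (reAt A i - u (e i)) + imAt w i * (imAt A i - u ((RCLike.I : 𝕜) • e i)) := by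
    ring
  rw [h3]
  refine (abs_add_le _ _).trans ?_
  rw [abs_mul, abs_mul, mul_add, mul_comm ε, mul_comm ε]
  exact add_le_add (mul_le_mul_of_nonneg_left h1 (abs_nonneg _))
    (mul_le_mul_of_nonneg_left h2 (abs_nonneg _))

omit [IsScalarTower ℝ 𝕜 X] in
theorem exists_approximates (e : ℕ → X) (u : StrongDual ℝ X) (s : ℕ) {ε : ℝ} (hε : 0 < ε) :
    ∃ A, Approximates 𝕜 e u A s ε := by
  have hd (x : ℝ) : ∃ n, |(ratNum n : ℝ) - x| ≤ ε := by
    obtain ⟨q, hq1, hq2⟩ := exists_rat_btwn (show x - ε < x by linarith)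
    obtain ⟨n, rfl⟩ := ratNum_surjective q
    exact ⟨n, abs_le.mpr ⟨by linarith, by linarith⟩⟩
  choose n hn using hd
  refine ⟨(List.range s).map fun i =>
    Nat.pair (n (u (e i))) (n (u ((RCLike.I : 𝕜) • e i))), fun i hi => ?_⟩
  simp only [reAt, imAt, getD_map_range, hi, if_true, Nat.unpair_pair]
  exact ⟨hn _, hn _⟩

theorem passes_iff {s : ℕ} {A w : List ℕ} {b : ℕ} : Passes s A w b ↔ (w.length ≤ s →
    (ratNum (codeDot w A w.length) : ℝ) ≤
      ratNum b + ((1 / 2) ^ s + (1 / 2) ^ s * ratNum (codeNorm w w.length))) := by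
  rw [Passes, codeLE_iff_real, ← not_le, ← imp_iff_not_or]
  simp only [ratNum_codeAdd, ratNum_codeMul, ratNum_codeHalfPow]
  push_cast
  rfl

/-- The slack in `Passes` is matched to this: one unit for the approximate norm, and one unit times
the coefficient sum for the approximate values. -/
theorem Approximates.admissible {e : ℕ → X} {ν : ℕ → ℕ → ℕ}
    (hν : ∀ m k, |‖combination 𝕜 e m‖ - (ratNum (ν m k) : ℝ)| ≤ (1 / 2) ^ k)
    {u : StrongDual ℝ X} (hu : ∀ y, |u y| ≤ ‖y‖) {A : List ℕ} {s : ℕ}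
    (h : Approximates 𝕜 e u A s ((1 / 2) ^ s)) : Admissible ν s A := by
  intro m _
  rw [passes_iff]
  intro hlen
  have h1 := h.dot hlen (by positivity)
  rw [Denumerable.encode_ofNat] at h1
  have h2 := abs_le.mp h1
  have h3 := (le_abs_self _).trans (hu (combination 𝕜 e m))
  have h4 := abs_le.mp (hν m s)
  linarith

/-- `gridBound` is chosen so that the tested combinations include all integer ones required by
`sum_le_norm_of_int` with `δ = (1 / 2) ^ s`. The criterion then applies with error `2 * δ`. The
vectors `e i` and `I • e i` are treated as separate real directions. -/
theorem exists_approximates_of_admissible {e : ℕ → X} {ν : ℕ → ℕ → ℕ}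
    (hν : ∀ m k, |‖combination 𝕜 e m‖ - (ratNum (ν m k) : ℝ)| ≤ (1 / 2) ^ k) {A : List ℕ} {s : ℕ}
    (h : Admissible ν s A) : ∃ u : StrongDual ℝ X, (∀ y, |u y| ≤ ‖y‖) ∧
      Approximates 𝕜 e u A s (2 * (1 / 2) ^ s) := by
  let x : Fin s ⊕ Fin s → X := Sum.elim (fun i => e i) fun i => (RCLike.I : 𝕜) • e i
  let a : Fin s ⊕ Fin s → ℝ := Sum.elim (fun i => reAt A i) fun i => imAt A i
  -- Covers the real case as well, where `I = 0` and the second family of vectors vanishes.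
  have hI (y : X) : ‖(RCLike.I : 𝕜) • y‖ ≤ ‖y‖ := by
    rw [norm_smul]
    refine mul_le_of_le_one_left (norm_nonneg _) ?_
    rcases (RCLike.I_mul_I_ax : (RCLike.I : 𝕜) = 0 ∨ _) with h | h
    · simp [h]
    · exact (RCLike.norm_I_of_ne_zero fun h0 => by simp [h0] at h).le
  have hx : ∑ i, ‖x i‖ + ∑ i, |a i| + (1 / 2) ^ s * (Fintype.card (Fin s ⊕ Fin s) + 2) ≤
      (1 / 2) ^ s * (gridBound ν s A : ℝ) := by
    have h1 : ∑ i, |a i| ≤ ((codeNorm A s).unpair.1.unpair.1 : ℝ) := by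
      refine le_trans ?_ (ratNum_le_numerator' _)
      refine le_trans (le_of_eq ?_) (sum_abs_le_codeNorm A s)
      rw [Fintype.sum_sum_type, Finset.sum_add_distrib, Finset.sum_range, Finset.sum_range]
      rfl
    have h2 : ∑ i ∈ Finset.range s, ‖e i‖ ≤ ((codeSum (fun i =>
        codeAdd (ν (multipleCode i (Nat.pair (codeNat 1) 0)) 0) (codeNat 1)) s).unpair.1.unpair.1 : ℝ) := by
      refine le_trans ?_ (ratNum_le_numerator' _)
      rw [ratNum_codeSum]
      push_cast
      refine Finset.sum_le_sum fun i _ => ?_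
      have h3 := abs_le.mp (hν (multipleCode i (Nat.pair (codeNat 1) 0)) 0)
      rw [combination_multipleCode, norm_smul, scalarNum] at h3
      simp only [Nat.unpair_pair, ratNum_codeNat, ratNum_zero, Nat.cast_one, Rat.cast_one,
        Rat.cast_zero, zero_mul, add_zero, norm_one, one_mul, pow_zero] at h3
      rw [ratNum_codeAdd, ratNum_codeNat]
      push_cast
      linarith
    have h3 : ∑ i, ‖x i‖ ≤ 2 * ∑ i ∈ Finset.range s, ‖e i‖ := by
      rw [Fintype.sum_sum_type, two_mul, Finset.sum_range]
      exact add_le_add le_rfl (Finset.sum_le_sum fun i _ => hI _)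
    have h4 : ((1 / 2 : ℝ) ^ s) * 2 ^ s = 1 := by
      rw [← mul_pow]
      norm_num
    rw [gridBound]
    push_cast
    rw [Fintype.card_sum, Fintype.card_fin]
    push_cast
    have h5 (c : ℝ) : (1 / 2) ^ s * (2 ^ s * c + 2 * s + 2) = c + (1 / 2) ^ s * (s + s + 2) := by
      linear_combination c * h4
    rw [h5]
    linarith
  have hint := sum_le_norm_of_int x a (by positivity) hx fun k hk => by
    let w : List ℕ := List.ofFn fun i : Fin s =>
      Nat.pair (codeInt (k (.inl i))) (codeInt (k (.inr i)))
    have hlen : w.length = s := List.length_ofFn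
    have hmem : Encodable.encode w < testBound ν s A := by
      refine Nat.lt_succ_of_le ?_
      have := encode_le_listBound (l := w) (b := Nat.pair
        (Nat.pair (Nat.pair (gridBound ν s A) (gridBound ν s A)) 0)
        (Nat.pair (Nat.pair (gridBound ν s A) (gridBound ν s A)) 0)) (by
          intro z hz
          obtain ⟨i, rfl⟩ := (List.mem_ofFn' _ _).mp hz
          exact pair_le_pair (codeInt_le (hk _)) (codeInt_le (hk _)))
      rwa [hlen] at this
    have hw (i : Fin s) : w.getD i 0 = Nat.pair (codeInt (k (.inl i))) (codeInt (k (.inr i))) := by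
      simp [w]
    have hre (i : Fin s) : reAt w i = k (.inl i) := by
      rw [reAt, hw]
      simp
    have him (i : Fin s) : imAt w i = k (.inr i) := by
      rw [imAt, hw]
      simp
    have h1 := h _ hmem
    rw [Denumerable.ofNat_encode, passes_iff] at h1
    have h2 := h1 hlen.le
    have h3 := abs_le.mp (hν (Encodable.encode w) s)
    rw [combination_encode, hlen, Finset.sum_range] at h3
    -- Exact rather than an upper bound, because `codeInt` stores only one non-zero part of the
    -- numerator.
    have h4 : (ratNum (codeNorm w s) : ℝ) = ∑ i, |(k i : ℝ)| := by
      rw [codeNorm, ratNum_codeSum, Finset.sum_range, Fintype.sum_sum_type,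
        ← Finset.sum_add_distrib]
      push_cast
      refine Finset.sum_congr rfl fun i _ => ?_
      rw [hw, Nat.unpair_pair, ratNum_codeAdd, ratNum_codeAbs_codeInt, ratNum_codeAbs_codeInt]
      push_cast
      rfl
    rw [hlen, ratNum_codeDot, Finset.sum_range, h4] at h2
    simp only [hre, him, Finset.sum_add_distrib] at h2 h3
    simp only [Fintype.sum_sum_type, x, a, Sum.elim_inl, Sum.elim_inr] at h2 ⊢
    linarith
  obtain ⟨u, hu, hua⟩ := exists_functional_of_sum_le x a (by positivity) hint
  refine ⟨u, hu, fun i hi => ⟨?_, ?_⟩⟩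
  · rw [abs_sub_comm]
    exact hua (.inl ⟨i, hi⟩)
  · rw [abs_sub_comm]
    exact hua (.inr ⟨i, hi⟩)

end

/-! ### Computable sequences of admissible lists and their limits. -/

section

open Filter Topology

variable {𝕜 : Type*} [RCLike 𝕜] {X : Type*} [NormedAddCommGroup X] [NormedSpace 𝕜 X]
  [NormedSpace ℝ X] [IsScalarTower ℝ 𝕜 X]

/-- Pass through a functional: `A` is within `2 * (1 / 2) ^ s` of its values, and a fresh
approximation at the next level is within another `(1 / 2) ^ s`. This is the `3` in `Near`. -/
theorem exists_near_admissible {e : ℕ → X} {ν : ℕ → ℕ → ℕ}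
    (hν : ∀ m k, |‖combination 𝕜 e m‖ - (ratNum (ν m k) : ℝ)| ≤ (1 / 2) ^ k) {A : List ℕ} {s : ℕ}
    (h : Admissible ν s A) : ∃ A', Admissible ν (s + 1) A' ∧ Near s A A' := by
  obtain ⟨u, hu, hA⟩ := exists_approximates_of_admissible hν h
  obtain ⟨A', hA'⟩ := exists_approximates (𝕜 := 𝕜) e u (s + 1)
    (show (0 : ℝ) < (1 / 2) ^ (s + 1) by positivity)
  refine ⟨A', hA'.admissible hν hu, near_iff.mpr fun i hi => ?_⟩
  have hp : (1 / 2 : ℝ) ^ (s + 1) ≤ (1 / 2) ^ s :=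
    pow_le_pow_of_le_one (by norm_num) (by norm_num) (Nat.le_succ s)
  obtain ⟨h1, h2⟩ := hA i hi
  obtain ⟨h3, h4⟩ := hA' i (hi.trans (Nat.lt_succ_self s))
  constructor
  · rw [abs_le] at h1 h3 ⊢
    constructor <;> linarith
  · rw [abs_le] at h2 h4 ⊢
    constructor <;> linarith

theorem exists_limit_of_abs_sub_le {a : ℕ → ℝ} {s : ℕ}
    (h : ∀ t, |a t - a (t + 1)| ≤ 3 * (1 / 2) ^ (s + t)) :
    ∃ l, Tendsto a atTop (𝓝 l) ∧ ∀ t, |a t - l| ≤ 6 * (1 / 2) ^ (s + t) := by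
  have h' : ∀ t, dist (a t) (a (t + 1)) ≤ 6 * (1 / 2) ^ s / 2 / 2 ^ t := fun t => by
    rw [Real.dist_eq]
    refine (h t).trans (le_of_eq ?_)
    rw [pow_add, one_div_pow (2 : ℝ) t]
    ring
  obtain ⟨l, hl⟩ := cauchySeq_tendsto_of_complete (cauchySeq_of_le_geometric_two h')
  refine ⟨l, hl, fun t => ?_⟩
  have := dist_le_of_le_geometric_two_of_tendsto h' hl t
  rw [Real.dist_eq] at this
  refine this.trans (le_of_eq ?_)
  rw [pow_add, one_div_pow (2 : ℝ) t]
  ring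

theorem computable_next {ν : ℕ → ℕ → ℕ} (hν : Computable₂ ν) (s : ℕ) :
    Computable fun z : (ℕ × ℕ) × ℕ =>
      decide (Admissible ν (s + z.1.1 + 1) (Denumerable.ofNat (List ℕ) z.2) ∧
        Near (s + z.1.1) (Denumerable.ofNat (List ℕ) z.1.2) (Denumerable.ofNat (List ℕ) z.2)) := by
  have ht : Computable fun z : (ℕ × ℕ) × ℕ => s + z.1.1 :=
    Primrec.nat_add.to_comp.comp (Computable.const s) (Computable.fst.comp Computable.fst)
  have hW := Computable.ofNat (List ℕ)
  have h1 := computable_admissible hν (Computable.succ.comp ht) (hW.comp Computable.snd)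
  have h2 := computable_near ht (hW.comp (Computable.snd.comp Computable.fst))
    (hW.comp Computable.snd)
  exact (Primrec.and.to_comp.comp h1 h2).of_eq fun z => (Bool.decide_and _ _).symm

theorem exists_admissible_seq {e : ℕ → X} {ν : ℕ → ℕ → ℕ} (hνc : Computable₂ ν)
    (hν : ∀ m k, |‖combination 𝕜 e m‖ - (ratNum (ν m k) : ℝ)| ≤ (1 / 2) ^ k) (s : ℕ)
    {A₀ : List ℕ} (h₀ : Admissible ν s A₀) :
    ∃ G : ℕ → List ℕ, Computable G ∧ G 0 = A₀ ∧ (∀ t, Admissible ν (s + t) (G t)) ∧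
      ∀ t, Near (s + t) (G t) (G (t + 1)) := by
  obtain ⟨G, hGc, hG0, hG, hGR⟩ := exists_computable_seq
    (R := fun t a b => Admissible ν (s + t + 1) (Denumerable.ofNat (List ℕ) b) ∧
      Near (s + t) (Denumerable.ofNat (List ℕ) a) (Denumerable.ofNat (List ℕ) b))
    (computable_next hνc s)
    (P := fun t a => Admissible ν (s + t) (Denumerable.ofNat (List ℕ) a))
    (a₀ := Encodable.encode A₀)
    (by rwa [Denumerable.ofNat_encode])
    (fun t a h => by
      obtain ⟨A', h1, h2⟩ := exists_near_admissible hν h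
      exact ⟨Encodable.encode A', by
        rw [Denumerable.ofNat_encode]
        exact ⟨h1, h2⟩⟩)
    (fun t a b _ h => h.1)
  refine ⟨fun t => Denumerable.ofNat (List ℕ) (G t), (Computable.ofNat _).comp hGc, ?_, hG,
    fun t => (hGR t).2⟩
  simp only [hG0, Denumerable.ofNat_encode]

/-- The functional `u₀` only supplies the starting list; the search may drift away from it, but the
limit is still given by some functional `u`. Steps of size `3 * (1 / 2) ^ (s + t)` sum to the factor
`6`. -/
theorem exists_approximates_seq {e : ℕ → X} {ν : ℕ → ℕ → ℕ} (hνc : Computable₂ ν)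
    (hν : ∀ m k, |‖combination 𝕜 e m‖ - (ratNum (ν m k) : ℝ)| ≤ (1 / 2) ^ k)
    {u₀ : StrongDual ℝ X} (hu₀ : ∀ y, |u₀ y| ≤ ‖y‖) (s : ℕ) :
    ∃ (u : StrongDual ℝ X) (G : ℕ → List ℕ), Computable G ∧
      Approximates 𝕜 e u₀ (G 0) s ((1 / 2) ^ s) ∧
      ∀ t, Approximates 𝕜 e u (G t) (s + t) (6 * (1 / 2) ^ (s + t)) := by
  obtain ⟨A₀, hA₀⟩ := exists_approximates (𝕜 := 𝕜) e u₀ s (show (0 : ℝ) < (1 / 2) ^ s by positivity)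
  obtain ⟨G, hGc, hG0, hG, hGR⟩ := exists_admissible_seq hνc hν s (hA₀.admissible hν hu₀)
  have hlim : ∀ i, ∃ c d : ℝ, Tendsto (fun t => reAt (G t) i) atTop (𝓝 c) ∧
      Tendsto (fun t => imAt (G t) i) atTop (𝓝 d) ∧ ∀ t, i < s + t →
        |reAt (G t) i - c| ≤ 6 * (1 / 2) ^ (s + t) ∧
        |imAt (G t) i - d| ≤ 6 * (1 / 2) ^ (s + t) := by
    intro i
    -- Consecutive lists are comparable at position `i` only once the level exceeds `i`, so each
    -- limit is taken from a later starting point and transferred back by `shift`.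
    have hn (r t : ℕ) (hr : i < s + r) := near_iff.mp (hGR (r + t)) i (by omega)
    have ex (r : ℕ) (hr : i < s + r) := exists_limit_of_abs_sub_le
      (a := fun t => reAt (G (r + t)) i) (s := s + r) fun t => by
        simpa only [add_assoc] using (hn r t hr).1
    have ex' (r : ℕ) (hr : i < s + r) := exists_limit_of_abs_sub_le
      (a := fun t => imAt (G (r + t)) i) (s := s + r) fun t => by
        simpa only [add_assoc] using (hn r t hr).2
    have shift (f : ℕ → ℝ) {c : ℝ} {r : ℕ} (h : Tendsto (fun t => f (r + t)) atTop (𝓝 c)) :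
        Tendsto f atTop (𝓝 c) :=
      (tendsto_add_atTop_iff_nat r).mp (by simpa only [add_comm] using h)
    obtain ⟨c, hc, -⟩ := ex (i + 1) (by omega)
    obtain ⟨d, hd, -⟩ := ex' (i + 1) (by omega)
    refine ⟨c, d, shift (fun t => reAt (G t) i) hc, shift (fun t => imAt (G t) i) hd, fun t ht => ?_⟩
    obtain ⟨c', hc', hc''⟩ := ex t ht
    obtain ⟨d', hd', hd''⟩ := ex' t ht
    rw [tendsto_nhds_unique (shift (fun t => reAt (G t) i) hc) (shift _ hc'),
      tendsto_nhds_unique (shift (fun t => imAt (G t) i) hd) (shift _ hd')]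
    exact ⟨hc'' 0, hd'' 0⟩
  choose c d hc hd hcd using hlim
  let x : ℕ ⊕ ℕ → X := Sum.elim e fun i => (RCLike.I : 𝕜) • e i
  let a : ℕ ⊕ ℕ → ℝ := Sum.elim c d
  -- The functionals `u t` at different levels are unrelated and need not converge; only their
  -- values at the vectors `x j` do.
  choose u hu hua using fun t => exists_approximates_of_admissible hν (hG t)
  have hp : Tendsto (fun t => 2 * (1 / 2 : ℝ) ^ (s + t)) atTop (𝓝 0) := by
    have h1 := tendsto_pow_atTop_nhds_zero_of_lt_one (by norm_num : (0 : ℝ) ≤ 1 / 2) (by norm_num)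
    have h2 := (tendsto_add_atTop_iff_nat s).mpr h1
    simpa only [mul_zero, add_comm] using h2.const_mul 2
  have hux : ∀ j, Tendsto (fun t => u t (x j)) atTop (𝓝 (a j)) := by
    have key {f g : ℕ → ℝ} {l : ℝ} {i : ℕ} (hf : Tendsto f atTop (𝓝 l))
        (h : ∀ t, i < s + t → |f t - g t| ≤ 2 * (1 / 2 : ℝ) ^ (s + t)) : Tendsto g atTop (𝓝 l) := by
      have h1 : Tendsto (fun t => f t - g t) atTop (𝓝 0) := by
        refine squeeze_zero_norm' ?_ hp
        filter_upwards [eventually_gt_atTop i] with t ht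
        exact h t (by omega)
      simpa using hf.sub h1
    rintro (i | i)
    · exact key (hc i) fun t ht => (hua t i ht).1
    · exact key (hd i) fun t ht => (hua t i ht).2
  -- Zero error is possible in the limit: the values `a` satisfy the norm inequality on every finite
  -- combination, as limits of the values of the `u t`.
  obtain ⟨v, -, hv⟩ := exists_functional_approx (Finsupp.linearCombination ℝ x)
    (Finsupp.linearCombination ℝ a) 0 fun l => by
      have h1 : Tendsto (fun t => u t (Finsupp.linearCombination ℝ x l)) atTop
          (𝓝 (Finsupp.linearCombination ℝ a l)) := by
        simp only [Finsupp.linearCombination_apply, Finsupp.sum, map_sum, map_smul]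
        exact tendsto_finsetSum _ fun j _ => (hux j).const_smul _
      simpa using le_of_tendsto h1 (Eventually.of_forall fun t => (le_abs_self _).trans (hu t _))
  have hva : ∀ j, v (x j) = a j := fun j => by
    have := hv (Finsupp.single j 1)
    simp only [Finsupp.linearCombination_single, one_smul, zero_apply] at this
    exact sub_eq_zero.mp (abs_nonpos_iff.mp this)
  refine ⟨v, G, hGc, ?_, fun t i hi => ?_⟩
  · rwa [hG0]
  · rw [show v (e i) = c i from hva (.inl i), show v ((RCLike.I : 𝕜) • e i) = d i from hva (.inr i)]
    exact hcd i t hi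

end

/-! ### A computable non-zero functional -/

/-- Multiplication by the imaginary unit on lists of codes of scalars. -/
def rotate (w : List ℕ) : List ℕ := w.map fun z => Nat.pair (codeNeg z.unpair.2) z.unpair.1

/-- The index of a sufficiently good approximation for the combination with coefficients `w`. -/
def precision (w : List ℕ) (k : ℕ) : ℕ :=
  k + 4 + w.length + (codeNorm w w.length).unpair.1.unpair.1

theorem primrec_rotate : Primrec rotate :=
  Primrec.list_map .id ((Primrec₂.natPair.comp (primrec_codeNeg.comp primrec_unpair_snd)
    primrec_unpair_fst).comp Primrec.snd).to₂

theorem computable_precision {α : Type*} [Primcodable α] {w : α → List ℕ} {k : α → ℕ}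
    (hw : Computable w) (hk : Computable k) : Computable fun a => precision (w a) (k a) := by
  have hl := Computable.list_length.comp hw
  have add := Primrec.nat_add.to_comp
  exact add.comp (add.comp (add.comp hk (Computable.const 4)) hl)
    ((primrec_unpair_fst.comp primrec_unpair_fst).to_comp.comp (computable_codeNorm hw hl))

theorem length_rotate (w : List ℕ) : (rotate w).length = w.length := List.length_map _

theorem getD_rotate {w : List ℕ} {i : ℕ} (hi : i < w.length) : (rotate w).getD i 0 =
    Nat.pair (codeNeg (w.getD i 0).unpair.2) (w.getD i 0).unpair.1 := by
  simp [rotate, hi]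

theorem reAt_rotate {w : List ℕ} {i : ℕ} (hi : i < w.length) : reAt (rotate w) i = -imAt w i := by
  rw [reAt, imAt, getD_rotate hi, Nat.unpair_pair, ratNum_codeNeg]
  push_cast
  rfl

theorem imAt_rotate {w : List ℕ} {i : ℕ} (hi : i < w.length) : imAt (rotate w) i = reAt w i := by
  simp only [reAt, imAt, getD_rotate hi, Nat.unpair_pair]

section

variable {𝕜 : Type*} [RCLike 𝕜] {X : Type*} [NormedAddCommGroup X] [NormedSpace 𝕜 X]
  [NormedSpace ℝ X] [IsScalarTower ℝ 𝕜 X]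

theorem combination_rotate (hI : (RCLike.I : 𝕜) ≠ 0) (e : ℕ → X) (w : List ℕ) :
    combination 𝕜 e (Encodable.encode (rotate w)) =
      (RCLike.I : 𝕜) • combination 𝕜 e (Encodable.encode w) := by
  rw [combination_encode, combination_encode, length_rotate, Finset.smul_sum]
  refine Finset.sum_congr rfl fun i hi => ?_
  have hi' := Finset.mem_range.mp hi
  have hII : (RCLike.I : 𝕜) * RCLike.I = -1 := RCLike.I_mul_I_ax.resolve_left hI
  rw [reAt_rotate hi', imAt_rotate hi', smul_add, smul_comm (RCLike.I : 𝕜) (reAt w i),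
    smul_comm (RCLike.I : 𝕜) (imAt w i), smul_smul (RCLike.I : 𝕜), hII, neg_one_smul, smul_neg,
    neg_smul, add_comm]

/-- In `precision` the length of `w` puts all its vectors within reach, the numerator absorbs the
sum of the coefficients, and the `4` turns the factor `6` into `6 / 16`. The remaining half is
needed because a scalar value combines two such estimates. -/
theorem Approximates.dot_precision {e : ℕ → X} {u : StrongDual ℝ X} {G : ℕ → List ℕ} {s : ℕ}
    (h : ∀ t, Approximates 𝕜 e u (G t) (s + t) (6 * (1 / 2) ^ (s + t))) {w : List ℕ} {k t : ℕ}
    (ht : precision w k ≤ t) :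
    |(ratNum (codeDot w (G t) w.length) : ℝ) - u (combination 𝕜 e (Encodable.encode w))| ≤
      (1 / 2) ^ k / 2 := by
  have hlen : w.length ≤ s + t := by
    unfold precision at ht
    omega
  refine ((h t).dot hlen (by positivity)).trans ?_
  set c := (codeNorm w w.length).unpair.1.unpair.1 with hc
  have h1 : (ratNum (codeNorm w w.length) : ℝ) ≤ 2 ^ c :=
    (ratNum_le_numerator' _).trans (by exact_mod_cast (Nat.lt_two_pow_self).le)
  have h2 : (1 / 2 : ℝ) ^ (s + t) ≤ (1 / 2) ^ (k + 4 + c) :=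
    pow_le_pow_of_le_one (by norm_num) (by norm_num) (by unfold precision at ht; omega)
  have h0 : (0 : ℝ) ≤ ratNum (codeNorm w w.length) :=
    (Finset.sum_nonneg fun _ _ => by positivity).trans (sum_abs_le_codeNorm w w.length)
  have h3 : (1 / 2 : ℝ) ^ c * 2 ^ c = 1 := by
    rw [← mul_pow]
    norm_num
  calc 6 * (1 / 2 : ℝ) ^ (s + t) * ratNum (codeNorm w w.length)
      ≤ 6 * (1 / 2) ^ (k + 4 + c) * 2 ^ c := by gcongr
    _ = 6 / 16 * (1 / 2) ^ k * ((1 / 2 : ℝ) ^ c * 2 ^ c) := by ring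
    _ ≤ (1 / 2) ^ k / 2 := by
      rw [h3]
      have : (0 : ℝ) < (1 / 2) ^ k := by positivity
      linarith

theorem exists_computable_functional_aux {e : ℕ → X} {ν : ℕ → ℕ → ℕ} (hνc : Computable₂ ν)
    (hν : ∀ m k, |‖combination 𝕜 e m‖ - (ratNum (ν m k) : ℝ)| ≤ (1 / 2) ^ k) {i₀ : ℕ}
    (hi₀ : e i₀ ≠ 0) :
    ∃ (f : StrongDual 𝕜 X) (φ : ℕ → ℕ → ℕ), f ≠ 0 ∧ Computable₂ φ ∧
      ∀ j k, ‖scalarNum 𝕜 (φ j k) - f (combination 𝕜 e j)‖ ≤ (1 / 2) ^ k := by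
  obtain ⟨u₀, hu₀, hu₀e⟩ := exists_dual_vector ℝ (e i₀) (norm_ne_zero_iff.mpr hi₀)
  have hu₀' : ∀ y, |u₀ y| ≤ ‖y‖ := fun y => by simpa [hu₀] using u₀.le_opNorm y
  -- The starting list is within one unit of the norming functional and within six of the limit, so
  -- seven units below `‖e i₀‖` keep the limit non-zero at `e i₀`. The level `n + (i₀ + 1)` used
  -- below also puts `e i₀` among the approximated vectors.
  obtain ⟨n, hn⟩ := exists_pow_lt_of_lt_one
    (show 0 < ‖e i₀‖ / 7 from div_pos (norm_pos_iff.mpr hi₀) (by norm_num))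
    (by norm_num : (1 / 2 : ℝ) < 1)
  obtain ⟨u, G, hG, h0, hu⟩ := exists_approximates_seq hνc hν hu₀' (n + (i₀ + 1))
  have hue : u (e i₀) ≠ 0 := by
    intro h
    have h1 := abs_le.mp (h0 i₀ (by omega)).1
    have h2 := abs_le.mp (hu 0 i₀ (by omega)).1
    have h3 : (1 / 2 : ℝ) ^ (n + (i₀ + 1)) ≤ (1 / 2) ^ n :=
      pow_le_pow_of_le_one (by norm_num) (by norm_num) (by omega)
    rw [h] at h2
    rw [hu₀e] at h1
    simp only [RCLike.ofReal_real_eq_id, id, add_zero] at h1 h2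
    linarith
  let W := Denumerable.ofNat (List ℕ)
  let t : ℕ → ℕ → ℕ := fun j k => precision (W j) k + precision (rotate (W j)) k
  let φ : ℕ → ℕ → ℕ := fun j k => Nat.pair (codeDot (W j) (G (t j k)) (W j).length)
    (codeNeg (codeDot (rotate (W j)) (G (t j k)) (rotate (W j)).length))
  -- The extension is `f x = u x - u (I • x) * I`; `rotate` provides the code of `I • x`, which
  -- explains the negated second component of `φ`.
  refine ⟨StrongDual.extendRCLike u, φ, fun h => hue ?_, ?_, fun j k => ?_⟩
  · have := StrongDual.re_extendRCLike_apply (𝕜 := 𝕜) u (e i₀)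
    rw [← this, h]
    simp
  · have hW : Computable fun z : ℕ × ℕ => W z.1 := (Computable.ofNat (List ℕ)).comp Computable.fst
    have hr := primrec_rotate.to_comp.comp hW
    have ht : Computable fun z : ℕ × ℕ => G (t z.1 z.2) := hG.comp (Primrec.nat_add.to_comp.comp
      (computable_precision hW Computable.snd) (computable_precision hr Computable.snd))
    exact (Primrec₂.natPair.to_comp.comp (computable_codeDot hW ht (Computable.list_length.comp hW))
      (primrec_codeNeg.to_comp.comp
        (computable_codeDot hr ht (Computable.list_length.comp hr)))).to₂
  · have h1 := Approximates.dot_precision hu (w := W j) (k := k) (t := t j k) (Nat.le_add_right _ _)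
    have h2 := Approximates.dot_precision hu (w := rotate (W j)) (k := k) (t := t j k)
      (Nat.le_add_left _ _)
    set D₁ := codeDot (W j) (G (t j k)) (W j).length
    set D₂ := codeDot (rotate (W j)) (G (t j k)) (rotate (W j)).length
    have hx : combination 𝕜 e (Encodable.encode (W j)) = combination 𝕜 e j := by
      rw [Denumerable.encode_ofNat]
    set x := combination 𝕜 e j
    rw [hx] at h1
    have h3 : scalarNum 𝕜 (φ j k) - StrongDual.extendRCLike u x =
        (((ratNum D₁ : ℝ) - u x : ℝ) : 𝕜) -
          (((ratNum D₂ : ℝ) - u ((RCLike.I : 𝕜) • x) : ℝ) : 𝕜) * RCLike.I := by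
      rw [StrongDual.extendRCLike_apply, scalarNum]
      simp only [φ, Nat.unpair_pair, ratNum_codeNeg]
      push_cast
      ring
    rw [h3]
    refine (norm_sub_le _ _).trans ?_
    rw [norm_mul, RCLike.norm_ofReal, RCLike.norm_ofReal]
    -- Over the reals `rotate` does not represent multiplication by `I = 0`, but the imaginary
    -- summand disappears.
    by_cases hI : (RCLike.I : 𝕜) = 0
    · rw [hI, norm_zero, mul_zero]
      have : (0 : ℝ) < (1 / 2) ^ k := by positivity
      linarith
    · rw [combination_rotate hI, hx] at h2
      rw [RCLike.norm_I_of_ne_zero hI, mul_one]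
      linarith

end

section

variable {𝕜 : Type*} [RCLike 𝕜] {X : Type*} [NormedAddCommGroup X] [NormedSpace 𝕜 X]
  [CompleteSpace X] [Nontrivial X]

theorem ComputableBanach.exists_basis_ne_zero (c : ComputableBanach 𝕜 X) :
    ∃ i, c.basis i ≠ 0 := by
  by_contra! h
  have h1 : Submodule.span 𝕜 (Set.range c.basis) = ⊥ := by
    rw [Submodule.span_eq_bot]
    rintro _ ⟨i, rfl⟩
    exact h i
  have h2 := c.dense_span.closure_eq
  rw [h1, Submodule.bot_coe, closure_singleton] at h2
  obtain ⟨x, hx⟩ := exists_ne (0 : X)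
  exact hx (h2.symm ▸ Set.mem_univ x : x ∈ ({0} : Set X))

theorem ComputableBanach.exists_computable_functional (c : ComputableBanach 𝕜 X) :
    ∃ (f : StrongDual 𝕜 X) (φ : ℕ → ℕ → ℕ), f ≠ 0 ∧ Computable₂ φ ∧
      ∀ j k, ‖scalarNum 𝕜 (φ j k) - f (c.metric.pt j)‖ ≤ (1 / 2) ^ k := by
  let _ : NormedSpace ℝ X := NormedSpace.restrictScalars ℝ 𝕜 X
  have _ : IsScalarTower ℝ 𝕜 X := .of_algebraMap_smul fun _ _ => rfl
  obtain ⟨ν, hνc, hν⟩ := c.exists_norm_approx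
  obtain ⟨i₀, hi₀⟩ := c.exists_basis_ne_zero
  exact exists_computable_functional_aux hνc hν hi₀

end

/-! ### Reduction of discrete choice to the Uniform Boundedness Theorem -/

/-- The least number that is not enumerated by `l`. -/
def candidate (l : List ℕ) : ℕ :=
  (List.range (l.length + 1)).findIdx fun n => decide (l.length ≤ l.idxOf (n + 1))

theorem primrec_candidate : Primrec candidate := by
  have h : Primrec₂ fun (l : List ℕ) (n : ℕ) => decide (l.length ≤ l.idxOf (n + 1)) :=
    Primrec.nat_le.decide.comp (Primrec.list_length.comp Primrec.fst)
      (Primrec.list_idxOf.comp (Primrec.succ.comp Primrec.snd) Primrec.fst)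
  exact Primrec.list_findIdx (Primrec.list_range.comp (Primrec.succ.comp Primrec.list_length)) h

/-- Pigeonhole: `l` cannot contain `l.length + 1` distinct numbers. This bounds the search in
`candidate`. -/
theorem exists_le_length_notMem (l : List ℕ) : ∃ n ≤ l.length, n + 1 ∉ l := by
  by_contra! h
  have h1 : (Finset.range (l.length + 1)).image Nat.succ ⊆ l.toFinset := fun m hm => by
    obtain ⟨n, hn, rfl⟩ := Finset.mem_image.mp hm
    exact List.mem_toFinset.mpr (h n (Nat.lt_succ_iff.mp (Finset.mem_range.mp hn)))
  have h2 := Finset.card_le_card h1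
  rw [Finset.card_image_of_injective _ Nat.succ_injective, Finset.card_range] at h2
  have := l.toFinset_card_le
  omega

theorem candidate_lt (l : List ℕ) : candidate l < (List.range (l.length + 1)).length := by
  obtain ⟨n, hn, hn'⟩ := exists_le_length_notMem l
  refine List.findIdx_lt_length_of_exists ⟨n, List.mem_range.mpr (Nat.lt_succ_of_le hn), ?_⟩
  simpa using not_lt.mp (mt List.idxOf_lt_length_iff.mp hn')

theorem candidate_notMem (l : List ℕ) : candidate l + 1 ∉ l := by
  have h := candidate_lt l
  unfold candidate at h ⊢
  have := List.findIdx_getElem (w := h)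
  simp only [List.getElem_range, decide_eq_true_eq] at this
  exact mt List.idxOf_lt_length_iff.mpr (not_lt.mpr this)

theorem candidate_le {l : List ℕ} {n : ℕ} (h : n + 1 ∉ l) : candidate l ≤ n := by
  by_contra! hlt
  have := List.not_of_lt_findIdx hlt
  simp only [List.getElem_range, decide_eq_false_iff_not, not_le] at this
  exact h (List.idxOf_lt_length_iff.mp this)

/-- The indicator, multiplied by `i + 1`, of the times `i` at which the candidate is refuted. -/
def refutation (p : Baire) (i : ℕ) : ℕ :=
  if p i = candidate ((List.range i).map p) + 1 then i + 1 else 0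

theorem oracleComputable_refutation : OracleComputable refutation := by
  have hc : OracleComputable fun p i => candidate ((List.range i).map p) :=
    OracleComputable.of_prefix (g := fun _ l => candidate l)
      (primrec_candidate.to_comp.comp Computable.snd) (.of_computable Computable.id)
  have h1 : Computable₂ fun a b : ℕ => (if a = b + 1 then 1 else 0 : ℕ) :=
    (Primrec.ite (Primrec.eq.comp Primrec.fst (Primrec.succ.comp Primrec.snd))
      (Primrec.const 1) (Primrec.const 0)).to_comp
  have h2 : Computable₂ fun a b : ℕ => a * (b + 1) :=
    (Primrec.nat_mul.comp Primrec.fst (Primrec.succ.comp Primrec.snd)).to_comp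
  have h := OracleComputable.comp_computable₂ h2
    (OracleComputable.comp_computable₂ h1 .oracle hc) (.of_computable Computable.id)
  simp only [ite_mul, one_mul, zero_mul, id] at h
  exact h

/-- Since `a` is never enumerated, candidates stay at most `a`; a refuted candidate is not in the
earlier prefix, so refutations enumerate pairwise different values. Thus `p` maps the refutation
times injectively into a finite set. -/
theorem exists_refutation_le {p : Baire} {a : ℕ} (ha : ∀ k, p k ≠ a + 1) :
    ∃ B, ∀ i, refutation p i ≤ B := by
  let S : Set ℕ := {i | p i = candidate ((List.range i).map p) + 1}
  have hmaps : Set.MapsTo p S (Set.Iic (a + 1)) := fun i hi => by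
    have : candidate ((List.range i).map p) ≤ a := candidate_le fun h => by
      obtain ⟨k, -, hk⟩ := List.mem_map.mp h
      exact ha k hk
    exact hi.le.trans (Nat.succ_le_succ this)
  have hlt : ∀ i j, i < j → j ∈ S → p i ≠ p j := fun i j hij hj heq =>
    candidate_notMem ((List.range j).map p)
      (hj ▸ List.mem_map.mpr ⟨i, List.mem_range.mpr hij, heq⟩)
  have hinj : Set.InjOn p S := fun i hi j hj heq => by
    rcases lt_trichotomy i j with h | h | h
    · exact absurd heq (hlt i j h hj)
    · exact h
    · exact absurd heq.symm (hlt j i h hi)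
  obtain ⟨B, hB⟩ := (Set.Finite.of_injOn hmaps hinj (Set.finite_Iic _)).bddAbove
  refine ⟨B + 1, fun i => ?_⟩
  rw [refutation]
  split_ifs with h
  · exact Nat.succ_le_succ (hB h)
  · exact Nat.zero_le _

/-- If the candidate after `M` stages were enumerated, let `m` be the first time; then `m ≥ M`. The
candidate is still the same at stage `m`, so `m` is a refutation of size `m + 1 > M`. -/
theorem ne_candidate_of_refutation_le {p : Baire} {M : ℕ} (hM : ∀ i, refutation p i ≤ M) (k : ℕ) :
    p k ≠ candidate ((List.range M).map p) + 1 := by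
  classical
  by_contra hk
  have hex : ∃ k, p k = candidate ((List.range M).map p) + 1 := ⟨k, hk⟩
  set m := Nat.find hex
  have hm : p m = candidate ((List.range M).map p) + 1 := Nat.find_spec hex
  have hMm : M ≤ m := by
    by_contra! hlt
    exact candidate_notMem _ (List.mem_map.mpr ⟨m, List.mem_range.mpr hlt, hm⟩)
  have hcand : candidate ((List.range m).map p) = candidate ((List.range M).map p) := by
    refine le_antisymm (candidate_le fun h => ?_) (candidate_le fun h => ?_)
    · obtain ⟨j, hj, hj'⟩ := List.mem_map.mp h
      exact Nat.find_min hex (List.mem_range.mp hj) hj'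
    · obtain ⟨j, hj, hj'⟩ := List.mem_map.mp h
      exact candidate_notMem ((List.range m).map p) (List.mem_map.mpr
        ⟨j, List.mem_range.mpr ((List.mem_range.mp hj).trans_le hMm), hj'⟩)
  have := hM m
  rw [refutation, if_pos (hcand ▸ hm)] at this
  omega

/-- The code of the multiple by the natural number `D` of the scalar with code `z`. -/
def codeScale (D z : ℕ) : ℕ :=
  Nat.pair (codeMul (codeNat D) z.unpair.1) (codeMul (codeNat D) z.unpair.2)

theorem scalarNum_codeScale {𝕜 : Type*} [RCLike 𝕜] (D z : ℕ) :
    scalarNum 𝕜 (codeScale D z) = D * scalarNum 𝕜 z := by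
  simp only [scalarNum, codeScale, Nat.unpair_pair, ratNum_codeMul, ratNum_codeNat]
  push_cast
  ring

theorem primrec₂_codeScale : Primrec₂ codeScale := by
  have h := primrec_codeNat.comp (Primrec.fst (α := ℕ) (β := ℕ))
  exact Primrec₂.natPair.comp
    (primrec₂_codeMul.comp h (primrec_unpair_fst.comp Primrec.snd))
    (primrec₂_codeMul.comp h (primrec_unpair_snd.comp Primrec.snd))

/-- The answers of an associate of the operator `x ↦ D * f x * e i₁` where `φ` approximates
the functional `f`. -/
def operatorAnswer (φ : ℕ → ℕ → ℕ) (i₁ F D a : ℕ) : ℕ :=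
  let v := Denumerable.ofNat (List ℕ) a.unpair.2
  let k := a.unpair.1 + 2 + D + F
  if v.length ≤ k then 0 else multipleCode i₁ (codeScale D (φ (v.getD k 0) k)) + 1

theorem computable₂_operatorAnswer {φ : ℕ → ℕ → ℕ} (hφ : Computable₂ φ) (i₁ F : ℕ) :
    Computable₂ (operatorAnswer φ i₁ F) := by
  have v : Computable fun z : ℕ × ℕ => Denumerable.ofNat (List ℕ) z.2.unpair.2 :=
    (Computable.ofNat _).comp (primrec_unpair_snd.to_comp.comp Computable.snd)
  have add := Primrec.nat_add.to_comp
  have k : Computable fun z : ℕ × ℕ => z.2.unpair.1 + 2 + z.1 + F :=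
    add.comp (add.comp (add.comp (primrec_unpair_fst.to_comp.comp Computable.snd)
      (Computable.const 2)) Computable.fst) (Computable.const F)
  have c := Primrec.nat_le.decide.to_comp.comp (Computable.list_length.comp v) k
  have r := primrec₂_multipleCode.to_comp.comp (Computable.const i₁)
    (primrec₂_codeScale.to_comp.comp Computable.fst
      (hφ.comp ((Primrec.list_getD 0).to_comp.comp v k) k))
  refine (Computable.cond c (Computable.const 0) (Computable.succ.comp r)).of_eq fun z => ?_
  simp only [operatorAnswer, Bool.cond_eq_ite, decide_eq_true_eq, Nat.succ_eq_add_one]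

/-! ### Rank-one operators with computable associates. -/

section

variable {𝕜 : Type*} [RCLike 𝕜] {X : Type*} [NormedAddCommGroup X] [NormedSpace 𝕜 X]
  [CompleteSpace X] {Y : Type*} [NormedAddCommGroup Y] [NormedSpace 𝕜 Y] [CompleteSpace Y]

theorem functionName_operatorAnswer {cX : ComputableBanach 𝕜 X} {cY : ComputableBanach 𝕜 Y}
    {f : StrongDual 𝕜 X} {φ : ℕ → ℕ → ℕ}
    (hφ : ∀ j k, ‖scalarNum 𝕜 (φ j k) - f (cX.metric.pt j)‖ ≤ (1 / 2) ^ k) {i₁ F : ℕ}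
    (hF : ‖cY.basis i₁‖ + ‖f‖ * ‖cY.basis i₁‖ ≤ F) {D : ℕ} {T : C(X, Y)}
    (hT : ∀ x, T x = (D : 𝕜) • f x • cY.basis i₁) :
    FunctionName cX.metric cY.metric (operatorAnswer φ i₁ F D) T := by
  intro q x hq
  -- Reading the `k n`-th digit gives error at most `(1 / 2) ^ k n` times `D * (1 + ‖f‖) * ‖cY.basis
  -- i₁‖`. The summands `D` and `F` absorb this factor through `D ≤ 2 ^ D` and `F ≤ 2 ^ F`.
  let k : ℕ → ℕ := fun n => n + 2 + D + F
  refine ⟨fun n => multipleCode i₁ (codeScale D (φ (q (k n)) (k n))), fun n => ⟨k n + 1,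
    fun j hj => ?_, ?_⟩, .of_dist_le fun n => ?_⟩
  · rw [operatorAnswer, query, Nat.unpair_pair, Denumerable.ofNat_encode]
    exact if_pos (by simpa using Nat.lt_succ_iff.mp hj)
  · rw [operatorAnswer, query, Nat.unpair_pair, Denumerable.ofNat_encode]
    simp only [List.length_map, List.length_range, getD_map_range]
    rw [if_neg (by simp only [k]; omega), if_pos (by simp only [k]; omega)]
  · change dist (combination 𝕜 cY.basis _) _ ≤ _
    rw [combination_multipleCode, scalarNum_codeScale, hT, dist_eq_norm, smul_smul, ← sub_smul,
      ← mul_sub, norm_smul, norm_mul, RCLike.norm_natCast]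
    have h1 : ‖scalarNum 𝕜 (φ (q (k n)) (k n)) - f x‖ ≤ (1 / 2) ^ k n * (1 + ‖f‖) := by
      have h2 := hφ (q (k n)) (k n)
      have h3 := f.le_opNorm (cX.metric.pt (q (k n)) - x)
      have h4 := hq.dist_le (k n)
      rw [dist_eq_norm] at h4
      rw [map_sub] at h3
      have h5 := norm_sub_le_norm_sub_add_norm_sub (scalarNum 𝕜 (φ (q (k n)) (k n)))
        (f (cX.metric.pt (q (k n)))) (f x)
      have h6 := mul_le_mul_of_nonneg_left h4 (norm_nonneg f)
      linarith
    have hD : (D : ℝ) ≤ 2 ^ D := by exact_mod_cast Nat.lt_two_pow_self.le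
    have hF' : (F : ℝ) ≤ 2 ^ F := by exact_mod_cast Nat.lt_two_pow_self.le
    have h2 (m : ℕ) : (1 / 2 : ℝ) ^ m * 2 ^ m = 1 := by
      rw [← mul_pow]
      norm_num
    calc (D : ℝ) * ‖scalarNum 𝕜 (φ (q (k n)) (k n)) - f x‖ * ‖cY.basis i₁‖
        ≤ D * ((1 / 2) ^ k n * (1 + ‖f‖)) * ‖cY.basis i₁‖ := by gcongr
      _ = (1 / 2) ^ k n * D * (‖cY.basis i₁‖ + ‖f‖ * ‖cY.basis i₁‖) := by ring
      _ ≤ (1 / 2) ^ k n * 2 ^ D * 2 ^ F := by gcongr; exact hF.trans hF'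
      _ = (1 / 2) ^ (n + 2) * ((1 / 2 : ℝ) ^ D * 2 ^ D) * ((1 / 2 : ℝ) ^ F * 2 ^ F) := by
        simp only [k]
        ring
      _ ≤ (1 / 2) ^ (n + 1) := by
        rw [h2, h2, mul_one, mul_one]
        exact pow_le_pow_of_le_one (by norm_num) (by norm_num) (by omega)

theorem discreteChoice_reducible_UBT [Nontrivial X] [Nontrivial Y] (cX : ComputableBanach 𝕜 X)
    (cY : ComputableBanach 𝕜 Y) : Reducible discreteChoice (UBT cX cY) := by
  obtain ⟨f, φ, hf, hφc, hφ⟩ := cX.exists_computable_functional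
  obtain ⟨i₁, hi₁⟩ := cY.exists_basis_ne_zero
  obtain ⟨F, hF⟩ := exists_nat_ge (‖cY.basis i₁‖ + ‖f‖ * ‖cY.basis i₁‖)
  let L₀ : X →L[𝕜] Y := f.smulRight (cY.basis i₁)
  have hL₀ : 0 < ‖L₀‖ := by
    rw [ContinuousLinearMap.norm_smulRight_apply]
    exact mul_pos (norm_pos_iff.mpr hf) (norm_pos_iff.mpr hi₁)
  -- Scaling by `C` makes the norm of the base operator at least one, so a bound of the operator
  -- norms also bounds the refutations.
  obtain ⟨C, hC⟩ := exists_nat_ge (1 / ‖L₀‖)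
  rw [div_le_iff₀ hL₀] at hC
  have hmul : Computable fun n : ℕ => n * C :=
    (Primrec.nat_mul.comp .id (Primrec.const C)).to_comp
  have hK : OracleComputable fun p N =>
      operatorAnswer φ i₁ F (refutation p N.unpair.1 * C) N.unpair.2 :=
    .comp_computable₂ (computable₂_operatorAnswer hφc i₁ F)
      ((OracleComputable.of_computable hmul).comp
        (oracleComputable_refutation.comp (.of_computable primrec_unpair_fst.to_comp)))
      (.of_computable primrec_unpair_snd.to_comp)
  have hg : Computable₂ fun (_ : ℕ) (l : List ℕ) =>
      candidate ((List.range (l.length / 2)).map fun j => l.getD (2 * j) 0) := by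
    have h : Primrec₂ fun (l : List ℕ) (j : ℕ) => l.getD (2 * j) 0 :=
      (Primrec.list_getD 0).comp Primrec.fst (Primrec.nat_double.comp Primrec.snd)
    exact (primrec_candidate.comp (Primrec.list_map (Primrec.list_range.comp
      (Primrec.nat_div.comp Primrec.list_length (Primrec.const 2))) h)).to_comp.comp Computable.snd
  -- The digit `r 1` of the interleaving is the bound `M`, and a prefix of length `2 * M` contains,
  -- at its even places, the first `M` values of `p`.
  have hH := OracleComputable.of_prefix hg (u := fun r _ => 2 * r 1)
    ((OracleComputable.of_computable Primrec.nat_double.to_comp).comp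
      (OracleComputable.oracle.comp (.of_computable (Computable.const 1))))
  refine ⟨_, _, hH.computableFun, hK.computableFun, fun G hG => ⟨_, ?_, rfl⟩⟩
  rintro p A hp ⟨a, ha⟩
  let L : ℕ → X →L[𝕜] Y := fun i => ((refutation p i * C : ℕ) : 𝕜) • L₀
  obtain ⟨B, hB⟩ := exists_refutation_le (p := p) (a := a) fun k hk =>
    absurd ha ((hp a).mpr ⟨k, hk⟩)
  let T : ℕ → C(X, Y) := fun i => L i
  have hT : (seqRep (functionRep cX.metric cY.metric)).Names (fun N =>
      operatorAnswer φ i₁ F (refutation p N.unpair.1 * C) N.unpair.2) T := fun i => by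
    simp only [Nat.unpair_pair]
    exact functionName_operatorAnswer hφ hF fun x => rfl
  obtain ⟨g, hgG, M, ⟨L', hL', hM⟩, hgM⟩ := hG _ T hT (by
      refine ⟨fun i => (L i).isBoundedLinearMap, fun x => ⟨(B * C : ℕ) * ‖L₀ x‖, ?_⟩⟩
      rintro _ ⟨i, rfl⟩
      change ‖((refutation p i * C : ℕ) : 𝕜) • L₀ x‖ ≤ _
      rw [norm_smul, RCLike.norm_natCast]
      exact mul_le_mul_of_nonneg_right
        (Nat.cast_le.mpr (Nat.mul_le_mul_right C (hB i))) (norm_nonneg _))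
  have hle : ∀ i, refutation p i ≤ M := fun i => by
    have h1 : L' i = L i := by
      ext x
      exact hL' i x
    have h2 := hM i
    rw [h1, norm_smul, RCLike.norm_natCast] at h2
    push_cast at h2
    have h3 : (refutation p i : ℝ) * 1 ≤ refutation p i * (C * ‖L₀‖) := by gcongr
    have h4 : (refutation p i : ℝ) ≤ M := by linarith
    exact_mod_cast h4
  refine ⟨fun _ => candidate ((List.range M).map p), ?_, _, ?_, fun _ => rfl⟩
  · simp only [composite, Part.bind_some, Part.mem_bind_iff]
    refine ⟨g, hgG, Part.mem_some_iff.mpr ?_⟩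
    funext _
    have h1 : pairing p g 1 = M := hgM 0
    have h2 : 2 * M / 2 = M := by omega
    simp only [h1, List.length_map, List.length_range, h2]
    congr 1
    refine List.map_congr_left fun j hj => ?_
    have hj' : 2 * j < 2 * M := by
      have := List.mem_range.mp hj
      omega
    rw [getD_map_range, if_pos hj']
    simp [pairing]
  · by_contra hnot
    obtain ⟨k, hk⟩ := (hp _).mp hnot
    exact ne_candidate_of_refutation_le hle k hk

end

end Weih

theorem mainTheorem5 {𝕜 : Type*} [RCLike 𝕜]
    {X : Type*} [NormedAddCommGroup X] [NormedSpace 𝕜 X] [CompleteSpace X] [Nontrivial X]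
    {Y : Type*} [NormedAddCommGroup Y] [NormedSpace 𝕜 Y] [CompleteSpace Y] [Nontrivial Y]
    (cX : Weih.ComputableBanach 𝕜 X) (cY : Weih.ComputableBanach 𝕜 Y) :
    Weih.Equivalent (Weih.UBT cX cY) Weih.discreteChoice :=
  ⟨Weih.UBT_reducible_discreteChoice cX cY, Weih.discreteChoice_reducible_UBT cX cY⟩
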